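/- **Conventions.** $n$ is the security parameter. A function is negligible if it is eventually smaller than $1/p(n)$ for every polynomial $p$. QPT algorithms are polynomial-time uniform families of quantum circuits (a classical algorithm outputs the $n$-th circuit in time polynomial in $n$) over Hadamard, $T$, NOT, CNOT, Toffoli gates and qubit resets; a QPT adversary may also make calls to an oracle (a channel from a plaintext register $M$ to a ciphertext register $C$). A *symmetric-key quantum encryption scheme* (SKQES) $\Pi=(\mathsf{KeyGen},\mathsf{Enc},\mathsf{Dec})$ consists of three QPT algorithms: $\mathsf{KeyGen}(1^n)$ outputs a classical key $k$ (for instance a uniformly random bit string); $\mathsf{Enc}_k$ is a channel from $M$ to $C$, and $\mathsf{Dec}_k$ a channel from $C$ to $M\oplus\bot$ (where it is measured whether the output is $\bot$); $M$ and $C$ consist of polynomially many qubits, their number depending only on $n$. It is required that $\|\mathsf{Dec}_k\circ\mathsf{Enc}_k-\mathrm{id}_M\oplus 0_\bot\|_\diamond\le\varepsilon(n)$ with a negligible $\varepsilon$, for all $k$ in the support of $\mathsf{KeyGen}(1^n)$. *Unforgeability.* Write encryption in the form $\mathsf{Enc}_k(X)=V_k(X\otimes\sigma_k)V_k^\dagger$,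 where $V_k:M\otimes T\to C$ is unitary, $T$ is a register of $t(n)$ qubits, $\sigma_k=\sum_r p_k(r)\,\Pi_{k,r}$ is a state, $p_k$ is a probability distribution on $\{0,1\}^{t(n)}$, and $\Pi_{k,r}=|\psi^{(k,r)}\rangle\langle\psi^{(k,r)}|$ for an orthonormal basis $(\psi^{(k,r)})_r$ of $T$. Put $\mathsf{Enc}_{k;r}(X)=V_k(X\otimes\Pi_{k,r})V_k^\dagger$, and let $\Pi^+$ be the projector onto the maximally entangled state $\phi^+$ of two copies of $M$. - In $\mathsf{QUF\text{-}Forge}(\Pi,\mathcal A,n)$ a key $k\leftarrow\mathsf{KeyGen}(1^n)$ is drawn, $\mathcal A$ gets oracle access to $\mathsf{Enc}_k$ and outputs a register $C_{\rm out}$; the experiment outputs $\mathsf{win}$ if $\mathsf{Dec}_k(C_{\rm out})\ne\bot$. - In $\mathsf{QUF\text{-}Cheat}(\Pi,\mathcal A,n)$ a key $k\leftarrow\mathsf{KeyGen}(1^n)$ is drawn. Every oracle call of $\mathcal A$ is answered as follows: the plaintext register is discarded, $\phi^+_{M'M''}$ is prepared, $\mathsf{Enc}_{k;r}$ with fresh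 $r\leftarrow p_k$ is applied to $M'$, the result is sent to $\mathcal A$, and $(M'',r)$ is stored. When $\mathcal A$ outputs $C_{\rm out}$, $V_k^\dagger$ is applied to it, giving registers $MT$. For each stored $(M'',r)$, in the order of storage, $\{\Pi_{k,r},1-\Pi_{k,r}\}$ is measured on $T$; on the first outcome, $\{\Pi^+,1-\Pi^+\}$ is measured on $MM''$, and on the first outcome of that the experiment stops with output $\mathsf{cheat}$. Otherwise the output is $\mathsf{reject}$. $\Pi$ is *QUF* if $\mathsf{Enc}$ can be written in this form (for all $n$ and all $k$ in the support of $\mathsf{KeyGen}(1^n)$) in such a way that, for every QPT adversary $\mathcal A$, the function $\bigl|\Pr[\mathsf{QUF\text{-}Forge}(\Pi,\mathcal A,n)\to\mathsf{win}]-\Pr[\mathsf{QUF\text{-}Cheat}(\Pi,\mathcal A,n)\to\mathsf{cheat}]\bigr|$ is negligible. *Secrecy.* $\Pi$ is *QIND-CPA* if for every pair $(\mathcal M,\mathcal D)$ of QPT algorithms, both with oracle access to $\mathsf{Enc}_k$, the function $$\Bigl|\Pr\bigl[\mathcal D\{(\mathsf{Enc}_k\otimes 1_E)\rho_{ME}\}=1\bigr]-\Pr\bigl[\mathcal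 D\{(\mathsf{Enc}_k\otimes 1_E)(|0\rangle\langle 0|_M\otimes\rho_E)\}=1\bigr]\Bigr|$$ is negligible, where $k\leftarrow\mathsf{KeyGen}(1^n)$, $\rho_{ME}\leftarrow\mathcal M(1^n)$ and $\rho_E=\mathrm{Tr}_M\rho_{ME}$. **Theorem.** If an SKQES is QUF, then it is QIND-CPA. -/

import Mathlib

namespace QEnc

open Matrix

noncomputable section

/-! ## Classical polynomial time

Programs act on binary trees (Lisp data).  The cost of a run charges every elementary instruction
with the size of the tree it handles, so the cost bounds the size of every tree that is ever built;
up to polynomial overhead this is the running time of a (multi-tape) Turing machine. -/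

/-- Binary trees: the data on which classical programs work. -/
inductive Data : Type
  | nil : Data
  | cons : Data → Data → Data

namespace Data

/-- The number of nodes of a tree. -/
def size : Data → ℕ
  | nil => 1
  | cons a b => a.size + b.size + 1

/-- The first component (`nil` for the empty tree). -/
def fst : Data → Data
  | nil => nil
  | cons a _ => a

/-- The second component (`nil` for the empty tree). -/
def snd : Data → Data
  | nil => nil
  | cons _ b => b

end Data

/-- Structured programs on binary trees. -/
inductive Prog : Type
  | id : Prog
  | nil : Prog
  | fst : Prog
  | snd : Prog
  /-- run two programs on the same input and pair the results -/
  | pair : Prog → Prog → Prog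
  /-- `comp f g` runs `g` and then `f` -/
  | comp : Prog → Prog → Prog
  /-- `cond b f g` runs `f` if `b` returns a non-empty tree, and `g` otherwise -/
  | cond : Prog → Prog → Prog → Prog
  /-- `loop b f` repeats `f` as long as `b` returns a non-empty tree -/
  | loop : Prog → Prog → Prog

/-- `P.Eval x y t`: on input `x` the program `P` halts with output `y` after `t` units of time. -/
inductive Prog.Eval : Prog → Data → Data → ℕ → Prop
  | id (x : Data) : Eval .id x x x.size
  | nil (x : Data) : Eval .nil x .nil x.size
  | fst (x : Data) : Eval .fst x x.fst x.size
  | snd (x : Data) : Eval .snd x x.snd x.size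
  | pair {f g : Prog} {x y z : Data} {s t : ℕ} :
      Eval f x y s → Eval g x z t → Eval (.pair f g) x (.cons y z) (x.size + s + t + 1)
  | comp {f g : Prog} {x y z : Data} {s t : ℕ} :
      Eval g x y s → Eval f y z t → Eval (.comp f g) x z (s + t + 1)
  | cond_true {b f g : Prog} {x u v y : Data} {s t : ℕ} :
      Eval b x (.cons u v) s → Eval f x y t → Eval (.cond b f g) x y (x.size + s + t + 1)
  | cond_false {b f g : Prog} {x y : Data} {s t : ℕ} :
      Eval b x .nil s → Eval g x y t → Eval (.cond b f g) x y (x.size + s + t + 1)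
  | loop_done {b f : Prog} {x : Data} {s : ℕ} :
      Eval b x .nil s → Eval (.loop b f) x x (x.size + s + 1)
  | loop_step {b f : Prog} {x u v y z : Data} {s t r : ℕ} :
      Eval b x (.cons u v) s → Eval f x y t → Eval (.loop b f) y z r →
        Eval (.loop b f) x z (x.size + s + t + r + 1)

/-- Objects that are written as trees, so that a classical program can output them. -/
class ToData (α : Type) where
  toData : α → Data

/-- Natural numbers are written in unary. -/
def natToData : ℕ → Data
  | 0 => .nil
  | n + 1 => .cons .nil (natToData n)

/-- Lists are written as nested pairs. -/
def listToData {α : Type} (f : α → Data) : List α → Data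
  | [] => .nil
  | a :: l => .cons (f a) (listToData f l)

instance : ToData ℕ := ⟨natToData⟩
instance (n : ℕ) : ToData (Fin n) := ⟨fun i => natToData i⟩
instance : ToData Unit := ⟨fun _ => .nil⟩
instance {α β : Type} [ToData α] [ToData β] : ToData (α × β) :=
  ⟨fun p => .cons (ToData.toData p.1) (ToData.toData p.2)⟩
instance {α β : Type} [ToData α] [ToData β] : ToData (α ⊕ β) :=
  ⟨Sum.elim (fun a => .cons .nil (ToData.toData a))
    (fun b => .cons (.cons .nil .nil) (ToData.toData b))⟩
instance {α : Type} [ToData α] : ToData (List α) := ⟨listToData ToData.toData⟩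

/-- `f` is computed, on input `1ⁿ`, in time polynomial in `n`. -/
def PolyTime (f : ℕ → Data) : Prop :=
  ∃ (P : Prog) (q : Polynomial ℕ), ∀ n : ℕ, ∃ t ≤ q.eval n, P.Eval (ToData.toData n) (f n) t

/-! ## Operators and channels on finite-dimensional systems

A register with basis `α` has the Hilbert space `ℂ^α`; operators on it are matrices.  Joint systems
have product bases. -/

/-- Operators on the Hilbert space with basis `α`. -/
abbrev Op (α : Type) : Type := Matrix α α ℂ

/-- Basis labels of a register of `n` qubits. -/
abbrev Bits (n : ℕ) : Type := Fin n → Bool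

/-- The all-zero basis label of a set of qubits. -/
def zeros {ι : Type} : ι → Bool := fun _ => false

/-- The projector `|x⟩⟨x|`. -/
def ketbra {α : Type} [DecidableEq α] (x : α) : Op α := Matrix.single x x 1

/-- `Φ ⊗ id` for a (linear) map `Φ` on operators. -/
def tensorId {α β ε : Type} (Φ : Op α → Op β) (X : Op (α × ε)) : Op (β × ε) :=
  Matrix.of fun p q => Φ (Matrix.of fun a a' => X (a, p.2) (a', q.2)) p.1 q.1

/-- Preparation: the map `|a⟩⟨a'| ↦ |J a⟩⟨J a'|`. -/
def prepare {α β : Type} [Fintype α] [DecidableEq β] (J : α → β) (X : Op α) : Op β :=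
  Matrix.of fun s s' => ∑ a, ∑ a', if J a = s ∧ J a' = s' then X a a' else 0

/-- Partial trace: a basis label `s` of the joint system consists of the part `keep s` that is kept
and the part `rest s` that is traced out. -/
def ptrace {α β γ : Type} [Fintype β] [DecidableEq α] [DecidableEq γ]
    (keep : β → α) (rest : β → γ) (X : Op β) : Op α :=
  Matrix.of fun a a' =>
    ∑ s, ∑ s', if keep s = a ∧ keep s' = a' ∧ rest s = rest s' then X s s' else 0

/-- The trace norm: the sum of the singular values. -/
def traceNorm {α : Type} [Fintype α] [DecidableEq α] (X : Op α) : ℝ :=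
  ∑ i, Real.sqrt ((Matrix.isHermitian_conjTranspose_mul_self X).eigenvalues i)

/-- The diamond norm of `Φ` is at most `ε`. -/
def DiamondLE {α β : Type} [Fintype α] [DecidableEq α] [Fintype β] [DecidableEq β]
    (Φ : Op α → Op β) (ε : ℝ) : Prop :=
  ∀ (d : ℕ) (X : Op (α × Fin d)), traceNorm X ≤ 1 → traceNorm (tensorId Φ X) ≤ ε

/-- Negligible functions: smaller than every inverse polynomial, asymptotically. -/
def Negligible (f : ℕ → ℝ) : Prop :=
  Asymptotics.SuperpolynomialDecay Filter.atTop (fun n : ℕ => (n : ℝ)) f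

/-! ## Quantum circuits -/

/-- Elementary operations on qubits labelled by `ι`: the universal gates Hadamard, `T`, CNOT,
together with NOT and Toffoli, and the operation that resets a qubit to `|0⟩`.
A controlled gate whose target is one of its controls does nothing. -/
inductive Gate (ι : Type) : Type
  | not : ι → Gate ι
  | had : ι → Gate ι
  | tee : ι → Gate ι
  /-- control, target -/
  | cnot : ι → ι → Gate ι
  /-- control, control, target -/
  | toffoli : ι → ι → ι → Gate ι
  | reset : ι → Gate ι

/-- The operator `|x⟩ ↦ |f x⟩`. -/
def mapMatrix {β : Type} [DecidableEq β] (f : β → β) : Op β :=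
  Matrix.of fun y x => if y = f x then 1 else 0

/-- The Hadamard gate on qubit `a`. -/
def hadMatrix {ι : Type} [Fintype ι] [DecidableEq ι] (a : ι) : Op (ι → Bool) :=
  Matrix.of fun y x =>
    if ∀ i, i ≠ a → y i = x i then
      (if x a = true ∧ y a = true then (-1 : ℂ) else 1) / (Real.sqrt 2 : ℂ)
    else 0

/-- The gate `T = diag(1, exp(iπ/4))` on qubit `a`. -/
def teeMatrix {ι : Type} [Fintype ι] [DecidableEq ι] (a : ι) : Op (ι → Bool) :=
  Matrix.diagonal fun x =>
    if x a = true then Complex.exp (Complex.I * (Real.pi : ℂ) / 4) else 1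

/-- The operator `|0⟩⟨b|` on qubit `a`. -/
def resetMatrix {ι : Type} [Fintype ι] [DecidableEq ι] (a : ι) (b : Bool) : Op (ι → Bool) :=
  Matrix.of fun y x => if x a = b ∧ y = Function.update x a false then 1 else 0

/-- Kraus operators of an elementary operation. -/
def Gate.kraus {ι : Type} [Fintype ι] [DecidableEq ι] : Gate ι → List (Op (ι → Bool))
  | .not a => [mapMatrix fun x => Function.update x a (!x a)]
  | .had a => [hadMatrix a]
  | .tee a => [teeMatrix a]
  | .cnot a b => [mapMatrix fun x =>
      if a ≠ b ∧ x a = true then Function.update x b (!x b) else x]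
  | .toffoli a b c => [mapMatrix fun x =>
      if a ≠ c ∧ b ≠ c ∧ x a = true ∧ x b = true then Function.update x c (!x c) else x]
  | .reset a => [resetMatrix a false, resetMatrix a true]

/-- The channel of an elementary operation. -/
def Gate.apply {ι : Type} [Fintype ι] [DecidableEq ι] (g : Gate ι) (X : Op (ι → Bool)) :
    Op (ι → Bool) :=
  (g.kraus.map fun K => K * X * Kᴴ).sum

/-- The channel of a circuit; the first element of the list is applied first. -/
def runGates {ι : Type} [Fintype ι] [DecidableEq ι] (gs : List (Gate ι)) (X : Op (ι → Bool)) :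
    Op (ι → Bool) :=
  gs.foldl (fun Y g => g.apply Y) X

instance {ι : Type} [ToData ι] : ToData (Gate ι) :=
  ⟨fun g => match g with
    | .not a => .cons (natToData 0) (ToData.toData a)
    | .had a => .cons (natToData 1) (ToData.toData a)
    | .tee a => .cons (natToData 2) (ToData.toData a)
    | .cnot a b => .cons (natToData 3) (ToData.toData (a, b))
    | .toffoli a b c => .cons (natToData 4) (ToData.toData (a, b, c))
    | .reset a => .cons (natToData 5) (ToData.toData a)⟩

/-! ## Symmetric-key quantum encryption schemes -/

/-- The qubits of the key generation circuit: the key, and work space. -/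
abbrev GenWire (κ w : ℕ) : Type := Fin κ ⊕ Fin w

/-- The qubits of the encryption circuit: key, plaintext, ciphertext, work space. -/
abbrev EncWire (κ m c w : ℕ) : Type := Fin κ ⊕ Fin m ⊕ Fin c ⊕ Fin w

/-- The qubits of the decryption circuit: key, ciphertext, plaintext, accept flag, work space. -/
abbrev DecWire (κ c m w : ℕ) : Type := Fin κ ⊕ Fin c ⊕ Fin m ⊕ Unit ⊕ Fin w

/-- The distribution of the key: run the circuit on `|0…0⟩` and measure the key register. -/
def keyDist {κ w : ℕ} (gs : List (Gate (GenWire κ w))) (k : Bits κ) : ℝ :=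
  (ptrace (fun s : GenWire κ w → Bool => s ∘ Sum.inl) (fun s => s ∘ Sum.inr)
    (runGates gs (ketbra zeros)) k k).re

/-- The encryption channel with key `k`: run the circuit on the key, the plaintext and zeros, and
return the ciphertext register. -/
def encChannel {κ m c w : ℕ} (gs : List (Gate (EncWire κ m c w))) (k : Bits κ)
    (X : Op (Bits m)) : Op (Bits c) :=
  ptrace
    (fun s : EncWire κ m c w → Bool => fun i => s (.inr (.inr (.inl i))))
    (fun s => ((fun i => s (.inl i) : Bits κ), (fun i => s (.inr (.inl i)) : Bits m),
      (fun i => s (.inr (.inr (.inr i))) : Bits w)))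
    (runGates gs (prepare (fun x : Bits m => Sum.elim k (Sum.elim x zeros)) X))

/-- The decryption channel with key `k`, into `M ⊕ ⊥` (`⊥` is the basis vector `none`): run the
circuit on the key, the ciphertext and zeros, and measure the accept flag; return the plaintext
register if it is `1`, and `⊥` otherwise. -/
def decChannel {κ c m w : ℕ} (gs : List (Gate (DecWire κ c m w))) (k : Bits κ)
    (Y : Op (Bits c)) : Op (Option (Bits m)) :=
  let Z : Op (Bits m × Bool) := ptrace
    (fun s : DecWire κ c m w → Bool =>
      ((fun i => s (.inr (.inr (.inl i))) : Bits m), s (.inr (.inr (.inr (.inl ()))))))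
    (fun s => ((fun i => s (.inl i) : Bits κ), (fun i => s (.inr (.inl i)) : Bits c),
      (fun i => s (.inr (.inr (.inr (.inr i)))) : Bits w)))
    (runGates gs (prepare (fun y : Bits c => Sum.elim k (Sum.elim y zeros)) Y))
  Matrix.of fun a a' => match a, a' with
    | some x, some x' => Z (x, true) (x', true)
    | none, none => ∑ x, Z (x, false) (x, false)
    | _, _ => 0

/-- The embedding `X ↦ X ⊕ 0` of operators on `M` into operators on `M ⊕ ⊥`. -/
def embedOption {α : Type} (X : Op α) : Op (Option α) :=
  Matrix.of fun a a' => match a, a' with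
    | some x, some x' => X x x'
    | _, _ => 0

/-- A symmetric-key quantum encryption scheme: uniform polynomial-time families of circuits for key
generation, encryption and decryption, on `κ n` key qubits (classical), `m n` plaintext qubits and
`c n` ciphertext qubits, such that decryption undoes encryption up to a negligible error. -/
structure SKQES where
  /-- key length -/
  κ : ℕ → ℕ
  /-- plaintext length -/
  m : ℕ → ℕ
  /-- ciphertext length -/
  c : ℕ → ℕ
  genWork : ℕ → ℕ
  encWork : ℕ → ℕ
  decWork : ℕ → ℕ
  genCircuit : ∀ n, List (Gate (GenWire (κ n) (genWork n)))
  encCircuit : ∀ n, List (Gate (EncWire (κ n) (m n) (c n) (encWork n)))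
  decCircuit : ∀ n, List (Gate (DecWire (κ n) (c n) (m n) (decWork n)))
  gen_uniform : PolyTime fun n => ToData.toData (κ n, genWork n, genCircuit n)
  enc_uniform : PolyTime fun n => ToData.toData (κ n, m n, c n, encWork n, encCircuit n)
  dec_uniform : PolyTime fun n => ToData.toData (κ n, c n, m n, decWork n, decCircuit n)
  correct : ∃ ε : ℕ → ℝ, Negligible ε ∧ ∀ n (k : Bits (κ n)), keyDist (genCircuit n) k ≠ 0 →
    DiamondLE
      (fun X => decChannel (decCircuit n) k (encChannel (encCircuit n) k X) - embedOption X) (ε n)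

namespace SKQES

variable (S : SKQES)

/-- The probability that key generation outputs `k`. -/
def keyProb (n : ℕ) (k : Bits (S.κ n)) : ℝ := keyDist (S.genCircuit n) k

/-- The encryption channel `Enc_k`. -/
def enc (n : ℕ) (k : Bits (S.κ n)) : Op (Bits (S.m n)) → Op (Bits (S.c n)) :=
  encChannel (S.encCircuit n) k

/-- The decryption channel `Dec_k`. -/
def dec (n : ℕ) (k : Bits (S.κ n)) : Op (Bits (S.c n)) → Op (Option (Bits (S.m n))) :=
  decChannel (S.decCircuit n) k

end SKQES

/-! ## Oracle circuits -/

/-- The qubits of an adversary: the plaintext register and the ciphertext register through which it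
talks to the challenger, and at least one qubit of work space. -/
abbrev AdvWire (m c w : ℕ) : Type := Fin m ⊕ Fin c ⊕ Fin (w + 1)

/-- Instructions of an oracle circuit: elementary operations and oracle calls. -/
inductive OGate (ι : Type) : Type
  | gate : Gate ι → OGate ι
  | query : OGate ι

instance {ι : Type} [ToData ι] : ToData (OGate ι) :=
  ⟨fun g => match g with
    | .gate h => .cons .nil (ToData.toData h)
    | .query => .nil⟩

/-- A challenger that receives the plaintext register in state on `M` and holds the memory `E`
answers a call through a channel `M ⊗ E → C ⊗ E'`.  The effect on the adversary's qubits: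
the plaintext register is handed over (and comes back as `|0…0⟩`), the old contents of the
ciphertext register are discarded, and the answer is placed there. -/
def oracleCall {m c w : ℕ} {ε ε' : Type} (Φ : Op (Bits m × ε) → Op (Bits c × ε'))
    (X : Op ((AdvWire m c w → Bool) × ε)) : Op ((AdvWire m c w → Bool) × ε') :=
  Matrix.of fun p q =>
    if (fun i => p.1 (.inl i)) = (zeros : Bits m) ∧ (fun i => q.1 (.inl i)) = (zeros : Bits m) then
      Φ (Matrix.of fun a a' => ∑ z : Bits c,
          X (Sum.elim a.1 (Sum.elim z fun i => p.1 (.inr (.inr i))), a.2)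
            (Sum.elim a'.1 (Sum.elim z fun i => q.1 (.inr (.inr i))), a'.2))
        (fun i => p.1 (.inr (.inl i)), p.2) (fun i => q.1 (.inr (.inl i)), q.2)
    else 0

/-- The joint state of an adversary and a challenger: the number `j` of calls made so far, and an
operator on the adversary's qubits and the challenger's memory after `j` calls. -/
abbrev JointState (m c w : ℕ) (Mem : ℕ → Type) : Type :=
  Σ j : ℕ, Op ((AdvWire m c w → Bool) × Mem j)

/-- One instruction of an oracle circuit. -/
def stepOracle {m c w : ℕ} {Mem : ℕ → Type}
    (call : ∀ j, Op (Bits m × Mem j) → Op (Bits c × Mem (j + 1)))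
    (s : JointState m c w Mem) : OGate (AdvWire m c w) → JointState m c w Mem
  | .gate g => ⟨s.1, tensorId g.apply s.2⟩
  | .query => ⟨s.1 + 1, oracleCall (call s.1) s.2⟩

/-- Run an oracle circuit. -/
def runOracle {m c w : ℕ} {Mem : ℕ → Type}
    (call : ∀ j, Op (Bits m × Mem j) → Op (Bits c × Mem (j + 1)))
    (gs : List (OGate (AdvWire m c w))) (s : JointState m c w Mem) : JointState m c w Mem :=
  gs.foldl (stepOracle call) s

/-- All qubits of the adversary are `0`, no calls have been made, the memory is in state `e`. -/
def startState (m c w : ℕ) {Mem : ℕ → Type} [DecidableEq (Mem 0)] (e : Mem 0) :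
    JointState m c w Mem :=
  ⟨0, ketbra (zeros, e)⟩

/-- The joint state of the ciphertext register and the challenger's memory. -/
def ciphertextPart {m c w : ℕ} {ε : Type} [Fintype ε] [DecidableEq ε]
    (X : Op ((AdvWire m c w → Bool) × ε)) : Op (Bits c × ε) :=
  ptrace (fun p : (AdvWire m c w → Bool) × ε => ((fun i => p.1 (.inr (.inl i)) : Bits c), p.2))
    (fun p => ((fun i => p.1 (.inl i) : Bits m), (fun i => p.1 (.inr (.inr i)) : Bits (w + 1)))) X

/-- The probability that the first qubit of the work space is measured as `1`. -/
def outputOne {m c w : ℕ} {ε : Type} [Fintype ε]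
    (X : Op ((AdvWire m c w → Bool) × ε)) : ℝ :=
  ∑ p : (AdvWire m c w → Bool) × ε, if p.1 (.inr (.inr 0)) = true then (X p p).re else 0

namespace SKQES

variable (S : SKQES)

/-- The memory of a challenger that only holds the key. -/
abbrev NoMem : ℕ → Type := fun _ => Unit

/-- The encryption oracle `Enc_k`. -/
def realCall (n : ℕ) (k : Bits (S.κ n)) (j : ℕ) :
    Op (Bits (S.m n) × NoMem j) → Op (Bits (S.c n) × NoMem (j + 1)) :=
  tensorId (S.enc n k)

/-! ### Unforgeability -/

/-- A QPT forger: a uniform polynomial-time family of oracle circuits.  Its output is the final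
content of the ciphertext register. -/
structure Forger where
  work : ℕ → ℕ
  circuit : ∀ n, List (OGate (AdvWire (S.m n) (S.c n) (work n)))
  uniform : PolyTime fun n => ToData.toData (work n, circuit n)

variable {S}

/-- The probability that the forgery experiment outputs `win`: the forger has access to `Enc_k`,
and its output is not decrypted to `⊥`. -/
def forgeProb (A : S.Forger) (n : ℕ) : ℝ :=
  ∑ k : Bits (S.κ n), S.keyProb n k *
    (let out := runOracle (S.realCall n k) (A.circuit n)
        (startState (S.m n) (S.c n) (A.work n) ())
     let C : Op (Bits (S.c n)) := ptrace Prod.fst Prod.snd (ciphertextPart out.2)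
     ∑ x : Bits (S.m n), (S.dec n k C (some x) (some x)).re)

variable (S)

/-- A way of writing encryption as `Enc_k(X) = V_k (X ⊗ σ_k) V_k†` with a unitary `V_k : M ⊗ T → C`
and a state `σ_k = ∑ᵣ p_k(r) |ψ^{(k,r)}⟩⟨ψ^{(k,r)}|` of a register `T` of `t` qubits, given in an
orthonormal basis of eigenvectors. -/
structure Decomposition where
  t : ℕ → ℕ
  p : ∀ n, Bits (S.κ n) → Bits (t n) → ℝ
  ψ : ∀ n, Bits (S.κ n) → OrthonormalBasis (Bits (t n)) ℂ (EuclideanSpace ℂ (Bits (t n)))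
  V : ∀ n, Bits (S.κ n) → Matrix (Bits (S.c n)) (Bits (S.m n) × Bits (t n)) ℂ
  p_nonneg : ∀ n k r, 0 ≤ p n k r
  p_sum : ∀ n k, ∑ r, p n k r = 1
  V_isometry : ∀ n k, S.keyProb n k ≠ 0 → (V n k)ᴴ * V n k = 1
  V_coisometry : ∀ n k, S.keyProb n k ≠ 0 → V n k * (V n k)ᴴ = 1
  enc_eq : ∀ n k, S.keyProb n k ≠ 0 → ∀ X : Op (Bits (S.m n)),
    S.enc n k X = V n k *
      Matrix.kroneckerMap (· * ·) X
        (∑ r, (p n k r : ℂ) • Matrix.vecMulVec (ψ n k r).ofLp (star (ψ n k r).ofLp)) *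
      (V n k)ᴴ

namespace Decomposition

variable {S} (D : S.Decomposition)

/-- The projector `Π_{k,r} = |ψ^{(k,r)}⟩⟨ψ^{(k,r)}|` on `T`. -/
def tagProj (n : ℕ) (k : Bits (S.κ n)) (r : Bits (D.t n)) : Op (Bits (D.t n)) :=
  Matrix.vecMulVec (D.ψ n k r).ofLp (star (D.ψ n k r).ofLp)

/-- Encryption with randomness `r`: `Enc_{k;r}(X) = V_k (X ⊗ Π_{k,r}) V_k†`. -/
def encWith (n : ℕ) (k : Bits (S.κ n)) (r : Bits (D.t n)) (X : Op (Bits (S.m n))) :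
    Op (Bits (S.c n)) :=
  D.V n k * Matrix.kroneckerMap (· * ·) X (D.tagProj n k r) * (D.V n k)ᴴ

/-- The challenger's memory in the cheat-detecting experiment after `j` calls: for each call, a
register `M''` and the randomness `r` (stored as a classical basis state). -/
abbrev CheatMem (n : ℕ) : ℕ → Type := fun j => Fin j → Bits (S.m n) × Bits (D.t n)

/-- The oracle of the cheat-detecting experiment: discard the plaintext, prepare the maximally
entangled state `φ⁺` on `M' M''`, apply `Enc_{k;r}` to `M'` with fresh randomness `r`, return the
result, and store `(M'', r)` in a new memory cell. -/
def cheatCall (n : ℕ) (k : Bits (S.κ n)) (j : ℕ)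
    (X : Op (Bits (S.m n) × D.CheatMem n j)) : Op (Bits (S.c n) × D.CheatMem n (j + 1)) :=
  Matrix.of fun u v =>
    if (u.2 (Fin.last j)).2 = (v.2 (Fin.last j)).2 then
      (D.p n k (u.2 (Fin.last j)).2 : ℂ) *
        ((1 / 2 ^ S.m n : ℂ) *
          D.encWith n k (u.2 (Fin.last j)).2
            (Matrix.single (u.2 (Fin.last j)).1 (v.2 (Fin.last j)).1 1) u.1 v.1) *
        ∑ a : Bits (S.m n), X (a, Fin.init u.2) (a, Fin.init v.2)
    else 0

/-- The projector `Π_{k,r}` on `T`, where `r` is the randomness stored in memory cell `i`. -/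
def tagTest (n : ℕ) (k : Bits (S.κ n)) {j : ℕ} (i : Fin j) :
    Op ((Bits (S.m n) × Bits (D.t n)) × D.CheatMem n j) :=
  Matrix.of fun u v =>
    if u.1.1 = v.1.1 ∧ u.2 = v.2 then D.tagProj n k (u.2 i).2 u.1.2 v.1.2 else 0

/-- The projector `Π⁺` onto the maximally entangled state of `M` and the register `M''` in memory
cell `i`. -/
def entTest (n : ℕ) {j : ℕ} (i : Fin j) :
    Op ((Bits (S.m n) × Bits (D.t n)) × D.CheatMem n j) :=
  Matrix.of fun u v =>
    if u.1.2 = v.1.2 ∧ (∀ l, l ≠ i → u.2 l = v.2 l) ∧ (u.2 i).2 = (v.2 i).2 ∧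
        u.1.1 = (u.2 i).1 ∧ v.1.1 = (v.2 i).1 then
      (1 / 2 ^ S.m n : ℂ)
    else 0

/-- The probability that the challenger outputs `cheat` when it goes through the memory cells in the
given list: for each cell, it measures `{Π_{k,r}, 1 - Π_{k,r}}` on `T` and, on the first outcome,
`{Π⁺, 1 - Π⁺}` on `M M''`; it outputs `cheat` on the first outcome and goes on otherwise. -/
def cheatLoop (n : ℕ) (k : Bits (S.κ n)) {j : ℕ} :
    List (Fin j) → Op ((Bits (S.m n) × Bits (D.t n)) × D.CheatMem n j) → ℝ
  | [], _ => 0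
  | i :: l, X =>
      let P := D.tagTest n k i
      let Q := D.entTest n i
      (Matrix.trace (Q * P * X * (Q * P)ᴴ)).re +
        cheatLoop n k l
          ((1 - P) * X * (1 - P)ᴴ + ((1 - Q) * P) * X * ((1 - Q) * P)ᴴ)

/-- The probability that the cheat-detecting experiment outputs `cheat`: after the forger's run,
`V_k†` is applied to its output, and the memory cells are tested in the order in which they were
filled. -/
def cheatProb (A : S.Forger) (n : ℕ) : ℝ :=
  ∑ k : Bits (S.κ n), S.keyProb n k *
    (let out := runOracle (D.cheatCall n k) (A.circuit n)
        (startState (S.m n) (S.c n) (A.work n) (Fin.elim0 : D.CheatMem n 0))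
     D.cheatLoop n k (List.finRange out.1)
       (tensorId (fun Y : Op (Bits (S.c n)) => (D.V n k)ᴴ * Y * D.V n k) (ciphertextPart out.2)))

end Decomposition

/-- Unforgeable ciphertexts (QUF): every QPT forger wins the forgery experiment with the same
probability, up to a negligible difference, as it is caught in the cheat-detecting experiment. -/
def IsQUF : Prop :=
  ∃ D : S.Decomposition, ∀ A : S.Forger,
    Negligible fun n => |forgeProb A n - D.cheatProb A n|

/-! ### Indistinguishability under chosen-plaintext attack -/

/-- A QPT adversary `(𝓜, 𝓓)` with oracle access to encryption.  `𝓜` outputs its plaintext register;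
all its other qubits are passed on to `𝓓`, together with the challenge ciphertext (in the ciphertext
register).  The output of `𝓓` is the measured first qubit of the work space. -/
structure CPAAdversary where
  work : ℕ → ℕ
  pre : ∀ n, List (OGate (AdvWire (S.m n) (S.c n) (work n)))
  post : ∀ n, List (OGate (AdvWire (S.m n) (S.c n) (work n)))
  uniform : PolyTime fun n => ToData.toData (work n, pre n, post n)

variable {S}

/-- The probability that `𝓓` outputs `1` when the challenge plaintext `ρ_{ME}` is subjected to the
channel `Φ` (depending on `k`) from the plaintext to the ciphertext register. -/
def cpaProb (A : S.CPAAdversary) (n : ℕ)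
    (Φ : Bits (S.κ n) → Op (Bits (S.m n)) → Op (Bits (S.c n))) : ℝ :=
  ∑ k : Bits (S.κ n), S.keyProb n k *
    (let s := runOracle (S.realCall n k) (A.pre n)
        (startState (S.m n) (S.c n) (A.work n) ())
     let s' : JointState (S.m n) (S.c n) (A.work n) NoMem :=
        ⟨s.1 + 1, oracleCall (tensorId (Φ k)) s.2⟩
     outputOne (runOracle (S.realCall n k) (A.post n) s').2)

variable (S)

/-- QIND-CPA: no QPT adversary with access to `Enc_k` can tell an encryption of its plaintext, i.e.
`(Enc_k ⊗ 1)(ρ_{ME})`, from `(Enc_k ⊗ 1)(|0⟩⟨0| ⊗ ρ_E)`. -/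
def IsQINDCPA : Prop :=
  ∀ A : S.CPAAdversary, Negligible fun n =>
    |cpaProb A n (fun k => S.enc n k) -
      cpaProb A n (fun k X => S.enc n k (Matrix.trace X • ketbra zeros))|

end SKQES

end

end QEnc

namespace QEnc

open Matrix
open scoped ComplexOrder

/-! ## Polynomial-time computable functions on trees -/

/-! The cheat-detecting oracle throws every plaintext away, so nothing that happens there can depend
on what is encrypted; QUF carries this blindness over to the real oracle.

Given a CPA adversary, let the forger F₁ run it with the plaintext register reset just before the
challenge query, and let F₀ run it unchanged. Both then turn the adversary's output bit into
something that the forgery experiment can see: on output 1 they submit a fresh encryption, on output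
0 the fixed state |0…0⟩. By correctness a fresh encryption is accepted up to a negligible error, so
the winning probability is Pr[output 1] up to that error and the probability that |0…0⟩ is accepted
(`abs_accept_finish_sub_le`, `abs_forgeProb_sub_cpaProb_le`). The latter is `zeroAccept`, and it is
negligible by QUF itself: a forger that does nothing submits exactly |0…0⟩, and with no stored cell
it can never be caught cheating (`forgeProb_idleForger`, `cheatProb_idleForger`).

The cheat probabilities of F₀ and F₁ are equal (`cheatProb_toForger_reset`), so QUF makes their
winning probabilities negligibly close, and hence also the two CPA probabilities.

The rest makes this rigorous for circuits. The choice between the two outputs cannot be a controlled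
oracle call, so the query is always made and its answer is then cleared under the control of the
output bit (`ptrace_finish`); the clearing borrows a plaintext qubit, and without plaintext qubits
secrecy is trivial. Correctness, a diamond norm bound, becomes a bound on acceptance probabilities
through the trace norm (`DiamondLE.sum_diag_le`). Finally, the forgers' circuits have to be output
by a polynomial-time program on trees. -/

theorem Prog.Eval.size_le {P : Prog} {x y : Data} {t : ℕ} (h : P.Eval x y t) : y.size ≤ t := by
  induction h with
  | id x => exact le_rfl
  | nil x => cases x <;> simp [Data.size]
  | fst x => cases x <;> simp [Data.size, Data.fst]; omega
  | snd x => cases x <;> simp [Data.size, Data.snd]; omega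
  | pair _ _ h1 h2 => simp only [Data.size]; omega
  | _ => omega

theorem eval_mono_nat (q : Polynomial ℕ) {a b : ℕ} (h : a ≤ b) : q.eval a ≤ q.eval b := by
  rw [Polynomial.eval_eq_sum, Polynomial.eval_eq_sum]
  exact Finset.sum_le_sum fun i _ => Nat.mul_le_mul_left _ (Nat.pow_le_pow_left h i)

/-- `F` is computed in time polynomial in the size of its argument. -/
def PolyComp (F : Data → Data) : Prop :=
  ∃ (P : Prog) (q : Polynomial ℕ), ∀ x, ∃ t ≤ q.eval x.size, P.Eval x (F x) t

/-- The running time bounds the size of the output, so the second program starts on an input of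
polynomial size and the time bounds compose. -/
theorem PolyTime.map {F : Data → Data} {f : ℕ → Data} (hF : PolyComp F) (hf : PolyTime f) :
    PolyTime fun n => F (f n) := by
  obtain ⟨P, q, hP⟩ := hF
  obtain ⟨Q, r, hQ⟩ := hf
  refine ⟨.comp P Q, r + q.comp r + 1, fun n => ?_⟩
  obtain ⟨s, hs, hs'⟩ := hQ n
  obtain ⟨t, ht, ht'⟩ := hP (f n)
  refine ⟨_, ?_, .comp hs' ht'⟩
  have := eval_mono_nat q (hs'.size_le.trans hs)
  simp only [Polynomial.eval_add, Polynomial.eval_comp, Polynomial.eval_one]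
  omega

theorem PolyTime.pair {f g : ℕ → Data} (hf : PolyTime f) (hg : PolyTime g) :
    PolyTime fun n => .cons (f n) (g n) := by
  obtain ⟨P, q, hP⟩ := hf
  obtain ⟨Q, r, hQ⟩ := hg
  refine ⟨.pair P Q, q + r + q + 2 * .X + 2, fun n => ?_⟩
  obtain ⟨s, hs, hs'⟩ := hP n
  obtain ⟨t, ht, ht'⟩ := hQ n
  refine ⟨_, ?_, .pair hs' ht'⟩
  have : ∀ n, (natToData n).size = 2 * n + 1 := by
    intro n
    induction n with
    | zero => rfl
    | succ n ih => simp only [natToData, Data.size, ih]; omega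
  have h1 := this n
  simp only [Polynomial.eval_add, Polynomial.eval_mul, Polynomial.eval_X, Polynomial.eval_ofNat,
    ToData.toData]
  omega

namespace PolyComp

theorem id : PolyComp fun x => x :=
  ⟨.id, .X, fun x => ⟨_, by simp, .id x⟩⟩

theorem nil : PolyComp fun _ => .nil :=
  ⟨.nil, .X, fun x => ⟨_, by simp, .nil x⟩⟩

theorem comp {F G : Data → Data} (hF : PolyComp F) (hG : PolyComp G) :
    PolyComp fun x => F (G x) := by
  obtain ⟨P, q, hP⟩ := hF
  obtain ⟨Q, r, hQ⟩ := hG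
  refine ⟨.comp P Q, r + q.comp r + 1, fun x => ?_⟩
  obtain ⟨s, hs, hs'⟩ := hQ x
  obtain ⟨t, ht, ht'⟩ := hP (G x)
  refine ⟨_, ?_, .comp hs' ht'⟩
  have := eval_mono_nat q (hs'.size_le.trans hs)
  simp only [Polynomial.eval_add, Polynomial.eval_comp, Polynomial.eval_one]
  omega

theorem fst {F : Data → Data} (hF : PolyComp F) : PolyComp fun x => (F x).fst :=
  comp (F := Data.fst) ⟨.fst, .X, fun x => ⟨_, by simp, .fst x⟩⟩ hF

theorem snd {F : Data → Data} (hF : PolyComp F) : PolyComp fun x => (F x).snd :=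
  comp (F := Data.snd) ⟨.snd, .X, fun x => ⟨_, by simp, .snd x⟩⟩ hF

theorem cons {F G : Data → Data} (hF : PolyComp F) (hG : PolyComp G) :
    PolyComp fun x => .cons (F x) (G x) := by
  obtain ⟨P, q, hP⟩ := hF
  obtain ⟨Q, r, hQ⟩ := hG
  refine ⟨.pair P Q, .X + q + r + 1, fun x => ?_⟩
  obtain ⟨s, hs, hs'⟩ := hP x
  obtain ⟨t, ht, ht'⟩ := hQ x
  refine ⟨_, ?_, .pair hs' ht'⟩
  simp only [Polynomial.eval_add, Polynomial.eval_X, Polynomial.eval_one]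
  omega

theorem const (d : Data) : PolyComp fun _ => d := by
  induction d with
  | nil => exact nil
  | cons a b ha hb => exact cons ha hb

end PolyComp

/-- Case distinction: is the tree empty? -/
def Data.ite : Data → Data → Data → Data
  | .nil, _, z => z
  | .cons _ _, y, _ => y

theorem PolyComp.ite {B F G : Data → Data} (hB : PolyComp B) (hF : PolyComp F) (hG : PolyComp G) :
    PolyComp fun x => (B x).ite (F x) (G x) := by
  obtain ⟨P, q, hP⟩ := hF
  obtain ⟨Q, r, hQ⟩ := hG
  obtain ⟨R, p, hR⟩ := hB
  refine ⟨.cond R P Q, .X + p + q + r + 1, fun x => ?_⟩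
  obtain ⟨s, hs, hs'⟩ := hP x
  obtain ⟨t, ht, ht'⟩ := hQ x
  obtain ⟨u, hu, hu'⟩ := hR x
  simp only [Polynomial.eval_add, Polynomial.eval_X, Polynomial.eval_one]
  cases h : B x with
  | nil => exact ⟨_, by omega, .cond_false (h ▸ hu') ht'⟩
  | cons a b => exact ⟨_, by omega, .cond_true (h ▸ hu') hs'⟩

/-- Iteration along the right spine of a tree; every step sees the remaining tree and the
accumulated value. -/
def foldSpine (G : Data → Data) : Data → Data → Data
  | .nil, acc => acc
  | .cons a l, acc => foldSpine G l (G (.cons (.cons a l) acc))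

/-- A polynomial-time step may double the accumulator, and iterating it would then be exponential.
The hypothesis `hb` allows only an additive growth, polynomial in the remaining spine, which keeps
the accumulator polynomial throughout. -/
theorem PolyComp.foldSpine {G : Data → Data} (hG : PolyComp G) (b : Polynomial ℕ)
    (hb : ∀ a l acc : Data,
      (G (.cons (.cons a l) acc)).size ≤ acc.size + b.eval (Data.cons a l).size)
    {F H : Data → Data} (hF : PolyComp F) (hH : PolyComp H) :
    PolyComp fun x => QEnc.foldSpine G (F x) (H x) := by
  have hstep : PolyComp fun x => .cons x.fst.snd (G x) := cons (snd (fst id)) hG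
  obtain ⟨P, q, hP⟩ := hstep
  -- `N` bounds the spine and `M` the accumulator for the whole run: each step shortens `l` by at
  -- least one node, which pays for a growth of `b.eval N`. The loop state is the pair (spine,
  -- accumulator), and `.fst` is the test for an unfinished spine.
  have key : ∀ (N M : ℕ) (l acc : Data), l.size ≤ N → acc.size + l.size * b.eval N ≤ M →
      ∃ t ≤ l.size * (3 * (N + M + 1) + q.eval (N + M + 1) + 3), (Prog.loop .fst P).Eval
        (.cons l acc) (.cons .nil (QEnc.foldSpine G l acc)) t := by
    intro N M l
    induction l with
    | nil =>
      intro acc hl hM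
      refine ⟨_, ?_, .loop_done (.fst _)⟩
      simp only [Data.size] at *
      omega
    | cons a l _ ih =>
      intro acc hl hM
      have h1 := (hb a l acc).trans (Nat.add_le_add_left (eval_mono_nat b hl) _)
      have hsz : (Data.cons a l).size = a.size + l.size + 1 := rfl
      have h2 : (Data.cons a l).size * b.eval N = a.size * b.eval N + l.size * b.eval N +
        b.eval N := by rw [hsz]; ring
      obtain ⟨t, ht, ht'⟩ := ih (G (.cons (.cons a l) acc)) (by omega) (by
        rw [h2] at hM
        omega)
      obtain ⟨s, hs, hs'⟩ := hP (.cons (.cons a l) acc)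
      refine ⟨_, ?_, .loop_step (.fst _) hs' ht'⟩
      have h3 : (Data.cons (.cons a l) acc).size ≤ N + M + 1 := by
        have : (Data.cons (.cons a l) acc).size = (Data.cons a l).size + acc.size + 1 := rfl
        omega
      have h4 := eval_mono_nat q h3
      rw [hsz]
      have h5 : ∀ C, (a.size + l.size + 1) * C = a.size * C + l.size * C + C := fun C => by ring
      rw [h5]
      omega
  obtain ⟨Q, r, hQ⟩ := cons hF hH
  have hloop : ∃ (P : Prog) (q : Polynomial ℕ), ∀ x, ∃ t ≤ q.eval x.size,
      P.Eval x (.cons .nil (QEnc.foldSpine G (F x) (H x))) t := by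
    let M : Polynomial ℕ := r + r * b.comp r
    refine ⟨.comp (.loop .fst P) Q, r + r * (3 * (r + M + 1) + q.comp (r + M + 1) + 3) + 1,
      fun x => ?_⟩
    obtain ⟨s, hs, hs'⟩ := hQ x
    have h1 : (Data.cons (F x) (H x)).size ≤ r.eval x.size := hs'.size_le.trans hs
    have h2 : (Data.cons (F x) (H x)).size = (F x).size + (H x).size + 1 := rfl
    have h3 : (F x).size ≤ r.eval x.size := by omega
    obtain ⟨t, ht, ht'⟩ := key (r.eval x.size) (M.eval x.size) (F x) (H x) h3 (by
      simp only [M, Polynomial.eval_add, Polynomial.eval_mul, Polynomial.eval_comp]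
      have := Nat.mul_le_mul_right (b.eval (r.eval x.size)) h3
      omega)
    refine ⟨_, ?_, .comp hs' ht'⟩
    have h4 := ht.trans (Nat.mul_le_mul_right _ h3)
    simp only [Polynomial.eval_add, Polynomial.eval_mul, Polynomial.eval_comp,
      Polynomial.eval_one, Polynomial.eval_ofNat]
    omega
  obtain ⟨P', q', h'⟩ := hloop
  exact snd (F := fun x => .cons .nil (QEnc.foldSpine G (F x) (H x))) ⟨P', q', h'⟩

/-- Concatenation of trees that represent lists. -/
def Data.append (l l' : Data) : Data :=
  foldSpine (fun x => .cons x.fst.fst x.snd)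
    (foldSpine (fun x => .cons x.fst.fst x.snd) l .nil) l'

theorem PolyComp.append {F G : Data → Data} (hF : PolyComp F) (hG : PolyComp G) :
    PolyComp fun x => (F x).append (G x) := by
  have h : PolyComp fun x => .cons x.fst.fst x.snd := cons (fst (fst id)) (snd id)
  have hb : ∀ a l acc : Data, ((fun x : Data => Data.cons x.fst.fst x.snd)
      (.cons (.cons a l) acc)).size ≤ acc.size + Polynomial.X.eval (Data.cons a l).size := by
    intro a l acc
    simp only [Data.fst, Data.snd, Data.size, Polynomial.eval_X]
    omega
  exact h.foldSpine .X hb (h.foldSpine .X hb hF nil) hG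

theorem append_listToData {α : Type} (f : α → Data) (l l' : List α) :
    (listToData f l).append (listToData f l') = listToData f (l ++ l') := by
  -- One fold prepends the reversed list; `Data.append` folds twice, so the order is restored.
  have h : ∀ l l' : List α, foldSpine (fun x => .cons x.fst.fst x.snd) (listToData f l)
      (listToData f l') = listToData f (l.reverse ++ l') := by
    intro l
    induction l with
    | nil => intro l'; rfl
    | cons a l ih =>
      intro l'
      have := ih (a :: l')
      simpa [listToData, foldSpine, Data.fst, Data.snd] using this
  have h1 := h l []
  rw [List.append_nil] at h1
  rw [Data.append]
  erw [h1]
  rw [h, List.reverse_reverse]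

/-- A unary number serves as a loop counter. The indices are visited downwards from `n - 1` and each
contribution is prepended, so the result lists them in increasing order. -/
theorem foldSpine_natToData {α : Type} (f : α → Data) (G : Data → Data) (g : ℕ → List α)
    (hG : ∀ n acc, G (.cons (natToData (n + 1)) (listToData f acc)) = listToData f (g n ++ acc))
    (n : ℕ) (acc : List α) :
    foldSpine G (natToData n) (listToData f acc) =
      listToData f ((List.range n).flatMap g ++ acc) := by
  induction n generalizing acc with
  | zero => rfl
  | succ n ih =>
    have := hG n acc
    rw [natToData] at this
    rw [natToData, foldSpine, this, ih, List.range_succ]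
    simp

theorem listToData_map {α β : Type} (f : β → Data) (g : α → β) (l : List α) :
    listToData f (l.map g) = listToData (fun a => f (g a)) l := by
  induction l with
  | nil => rfl
  | cons a l ih => simp [listToData, ih]

/-! ## Completely positive and trace-preserving maps -/

/-- Complete positivity (of an additive map). -/
structure CP {α β : Type} [Fintype α] [Fintype β] (Φ : Op α → Op β) : Prop where
  add : ∀ X Y, Φ (X + Y) = Φ X + Φ Y
  smul : ∀ (c : ℂ) X, Φ (c • X) = c • Φ X
  pos : ∀ {ε : Type} [Fintype ε] (X : Op (α × ε)), X.PosSemidef → (tensorId Φ X).PosSemidef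

/-- Trace preservation. -/
def TP {α β : Type} [Fintype α] [Fintype β] (Φ : Op α → Op β) : Prop :=
  ∀ X, (Φ X).trace = X.trace

theorem tensorId_comp {α β γ ε : Type} (Φ : Op β → Op γ) (Ψ : Op α → Op β) (X : Op (α × ε)) :
    tensorId (fun Y => Φ (Ψ Y)) X = tensorId Φ (tensorId Ψ X) := rfl

theorem prepare_eq {α β : Type} [Fintype α] [DecidableEq β] (J : α → β) (X : Op α) :
    prepare J X = Matrix.of (fun b a => if J a = b then (1 : ℂ) else 0) * X *
      (Matrix.of (fun b a => if J a = b then (1 : ℂ) else 0))ᴴ := by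
  ext b b'
  simp only [prepare, of_apply, mul_apply, conjTranspose_apply, Finset.sum_mul]
  rw [Finset.sum_comm]
  refine Finset.sum_congr rfl fun a _ => Finset.sum_congr rfl fun a' _ => ?_
  split_ifs <;> simp_all

/-- Kraus form with one operator for each value of the discarded part, as needed for complete
positivity. -/
theorem ptrace_eq {α β γ : Type} [Fintype β] [Fintype γ] [DecidableEq α] [DecidableEq γ] (keep : β → α) (rest : β → γ) (X : Op β) :
    ptrace keep rest X =
      ∑ g, Matrix.of (fun a s => if keep s = a ∧ rest s = g then (1 : ℂ) else 0) * X *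
        (Matrix.of (fun a s => if keep s = a ∧ rest s = g then (1 : ℂ) else 0))ᴴ := by
  ext a a'
  simp only [ptrace, of_apply, Matrix.sum_apply, mul_apply, conjTranspose_apply, Finset.sum_mul]
  have : ∀ (g : γ) (s' s : β), (if keep s = a ∧ rest s = g then (1 : ℂ) else 0) * X s s' *
      star (if keep s' = a' ∧ rest s' = g then (1 : ℂ) else 0) =
      if g = rest s then
        (if keep s = a ∧ keep s' = a' ∧ rest s = rest s' then X s s' else 0) else 0 := by
    intro g s' s
    by_cases h1 : rest s = g
    · subst h1
      by_cases h2 : keep s = a <;> by_cases h3 : keep s' = a' <;>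
        by_cases h4 : rest s' = rest s <;> simp [h2, h3, h4, eq_comm]
    · simp [h1, Ne.symm h1]
  simp only [this]
  rw [Finset.sum_comm]
  conv_rhs => rw [Finset.sum_comm]
  refine Finset.sum_congr rfl fun s' _ => ?_
  conv_rhs => rw [Finset.sum_comm]
  simp

/-- A label is determined by its two parts, so on the diagonal only the terms with `s = s'` survive.
-/
theorem TP.ptrace {α β γ : Type} [Fintype α] [Fintype β] [DecidableEq α] [DecidableEq γ] {keep : β → α} {rest : β → γ}
    (h : ∀ s s', keep s = keep s' → rest s = rest s' → s = s') : TP (ptrace keep rest) := by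
  intro X
  simp only [Matrix.trace, Matrix.diag, QEnc.ptrace, of_apply]
  rw [Finset.sum_comm]
  refine Finset.sum_congr rfl fun s _ => ?_
  rw [Finset.sum_comm]
  classical
  rw [Finset.sum_eq_single s]
  · simp
  · intro s' _ hs'
    refine Finset.sum_eq_zero fun b _ => if_neg ?_
    rintro ⟨rfl, h1, h2⟩
    exact hs' (h _ _ h1 h2.symm)
  · simp

section
variable {α β γ : Type} [Fintype α] [Fintype β] [Fintype γ]

theorem CP.zero_map {Φ : Op α → Op β} (h : CP Φ) : Φ 0 = 0 := by
  simpa using h.smul 0 0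

theorem CP.sum_map {Φ : Op α → Op β} (h : CP Φ) {σ : Type} (s : Finset σ) (X : σ → Op α) :
    Φ (∑ i ∈ s, X i) = ∑ i ∈ s, Φ (X i) :=
  map_sum (⟨⟨Φ, h.zero_map⟩, h.add⟩ : Op α →+ Op β) X s

theorem CP.comp {Φ : Op β → Op γ} {Ψ : Op α → Op β} (hΦ : CP Φ) (hΨ : CP Ψ) :
    CP fun X => Φ (Ψ X) where
  add X Y := by rw [hΨ.add, hΦ.add]
  smul c X := by rw [hΨ.smul, hΦ.smul]
  pos X hX := hΦ.pos _ (hΨ.pos _ hX)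

theorem CP.id : CP fun X : Op α => X := ⟨fun _ _ => rfl, fun _ _ => rfl, fun _ hX => hX⟩

theorem CP.posSemidef {Φ : Op α → Op β} (h : CP Φ) {X : Op α} (hX : X.PosSemidef) :
    (Φ X).PosSemidef :=
  (h.pos (ε := Unit) (X.submatrix Prod.fst Prod.fst) (hX.submatrix _)).submatrix
    fun b : β => (b, ())

theorem cp_of_kraus {σ : Type} (s : Finset σ) (K : σ → Matrix β α ℂ) {Φ : Op α → Op β}
    (h : ∀ X, Φ X = ∑ i ∈ s, K i * X * (K i)ᴴ) : CP Φ where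
  add X Y := by simp only [h, Matrix.mul_add, Matrix.add_mul, Finset.sum_add_distrib]
  smul c X := by simp only [h, Matrix.mul_smul, Matrix.smul_mul, Finset.smul_sum]
  pos {ε} _ X hX := by
    classical
    have : tensorId Φ X = ∑ i ∈ s, kroneckerMap (· * ·) (K i) (1 : Op ε) * X *
        (kroneckerMap (· * ·) (K i) (1 : Op ε))ᴴ := by
      ext ⟨b, e⟩ ⟨b', e'⟩
      simp [tensorId, h, Matrix.sum_apply, Matrix.mul_apply, Fintype.sum_prod_type,
        Matrix.one_apply, apply_ite, Finset.sum_ite_eq]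
    rw [this]
    exact Matrix.posSemidef_sum _ fun i _ => hX.mul_mul_conjTranspose_same _

theorem TP.comp {Φ : Op β → Op γ} {Ψ : Op α → Op β} (hΦ : TP Φ) (hΨ : TP Ψ) :
    TP fun X => Φ (Ψ X) := fun X => (hΦ _).trans (hΨ X)

theorem TP.tensorId {ε : Type} [Fintype ε] {Φ : Op α → Op β} (h : TP Φ) :
    TP (tensorId (ε := ε) Φ) := by
  intro X
  simp only [Matrix.trace, Matrix.diag, QEnc.tensorId, Matrix.of_apply, Fintype.sum_prod_type]
  rw [Finset.sum_comm]
  conv_rhs => rw [Finset.sum_comm]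
  exact Finset.sum_congr rfl fun e _ => h (Matrix.of fun a a' => X (a, e) (a', e))

theorem CP.prepare [DecidableEq β] (J : α → β) : CP (prepare J) :=
  cp_of_kraus Finset.univ (fun _ : Unit => _) fun X => by
    rw [Finset.univ_unique, Finset.sum_singleton, prepare_eq]

theorem TP.prepare [DecidableEq β] {J : α → β} (hJ : Function.Injective J) :
    TP (prepare J) := by
  intro X
  simp only [Matrix.trace, Matrix.diag, QEnc.prepare, of_apply]
  rw [Finset.sum_comm]
  refine Finset.sum_congr rfl fun a _ => ?_
  rw [Finset.sum_comm]
  classical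
  rw [Finset.sum_eq_single a]
  · simp
  · intro a' _ ha'
    refine Finset.sum_eq_zero fun b _ => if_neg ?_
    rintro ⟨rfl, h⟩
    exact ha' (hJ h)
  · simp

theorem CP.ptrace [DecidableEq α] [DecidableEq γ] (keep : β → α) (rest : β → γ) :
    CP (ptrace keep rest) :=
  cp_of_kraus Finset.univ _ (ptrace_eq keep rest)

end

/-! ### Elementary gates are trace-preserving completely positive maps -/

section
variable {ι : Type} [Fintype ι] [DecidableEq ι]

theorem CP.gate (g : Gate ι) : CP g.apply := by
  refine cp_of_kraus Finset.univ (fun i : Fin g.kraus.length => g.kraus.get i) fun X => ?_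
  rw [Gate.apply, ← List.sum_ofFn]
  congr 1
  apply List.ext_get <;> simp

theorem CP.runGates (gs : List (Gate ι)) : CP (runGates gs) := by
  induction gs with
  | nil => exact CP.id
  | cons g gs ih => exact ih.comp (CP.gate g)

theorem mapMatrix_unitary {β : Type} [Fintype β] [DecidableEq β] {f : β → β}
    (hf : Function.Injective f) : (mapMatrix f)ᴴ * mapMatrix f = 1 := by
  ext x y
  simp [mapMatrix, mul_apply, Matrix.one_apply, apply_ite, hf.eq_iff, eq_comm]

theorem trace_conj {β : Type} [Fintype β] [DecidableEq β] {M : Op β} (h : Mᴴ * M = 1)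
    (X : Op β) : (M * X * Mᴴ).trace = X.trace := by
  rw [Matrix.trace_mul_comm, ← Matrix.mul_assoc, h, Matrix.one_mul]

theorem sum_agree_off (a : ι) (x : ι → Bool) (g : (ι → Bool) → ℂ) :
    ∑ y, (if ∀ i, i ≠ a → y i = x i then g y else 0) = ∑ b, g (Function.update x a b) := by
  rw [← Finset.sum_filter]
  symm
  refine Finset.sum_bij (fun b _ => Function.update x a b) ?_ ?_ ?_ ?_
  · intro b _
    simp only [Finset.mem_filter, Finset.mem_univ, true_and]
    exact fun i hi => Function.update_of_ne hi _ _
  · intro b _ b' _ h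
    simpa using congrFun h a
  · intro y hy
    simp only [Finset.mem_filter, Finset.mem_univ, true_and] at hy
    refine ⟨y a, Finset.mem_univ _, ?_⟩
    ext i
    by_cases hi : i = a
    · subst hi; simp
    · rw [Function.update_of_ne hi, hy i hi]
  · exact fun _ _ => rfl

theorem hadMatrix_unitary (a : ι) : (hadMatrix a)ᴴ * hadMatrix a = 1 := by
  ext x x'
  have h2 : ((Real.sqrt 2 : ℝ) : ℂ) * (Real.sqrt 2 : ℝ) = 2 := by
    rw [← Complex.ofReal_mul, Real.mul_self_sqrt (by norm_num)]; norm_num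
  have h0 : ((Real.sqrt 2 : ℝ) : ℂ) ≠ 0 := by
    intro h; rw [h] at h2; norm_num at h2
  have hs : ∀ y, star (hadMatrix a y x) = hadMatrix a y x := by
    intro y
    simp only [hadMatrix, of_apply]
    split_ifs <;> simp
  simp only [mul_apply, conjTranspose_apply, hs]
  simp only [hadMatrix, of_apply, ite_mul, zero_mul, sum_agree_off, Fintype.sum_bool]
  by_cases hx : ∀ i, i ≠ a → x i = x' i
  · have hu : ∀ b : Bool, ∀ i, i ≠ a → Function.update x a b i = x' i := fun b i hi => by
      rw [Function.update_of_ne hi, hx i hi]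
    have he : x = x' ↔ x a = x' a := by
      refine ⟨fun h => h ▸ rfl, fun h => funext fun i => ?_⟩
      by_cases hi : i = a
      · rw [hi, h]
      · exact hx i hi
    simp only [Matrix.one_apply, he, if_pos (hu _), Function.update_self]
    rcases x a <;> rcases x' a <;> simp <;> field_simp <;> rw [pow_two, h2] <;> norm_num
  · have hu : ∀ b : Bool, ¬ ∀ i, i ≠ a → Function.update x a b i = x' i := fun b h =>
      hx fun i hi => by rw [← h i hi, Function.update_of_ne hi]
    have he : x ≠ x' := fun h => hx fun i _ => h ▸ rfl
    simp [if_neg (hu _), he]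

theorem teeMatrix_unitary (a : ι) : (teeMatrix a)ᴴ * teeMatrix a = 1 := by
  rw [teeMatrix, diagonal_conjTranspose, diagonal_mul_diagonal, ← diagonal_one]
  congr 1
  ext x
  simp only [Pi.star_apply]
  split_ifs
  · rw [show star (Complex.exp (Complex.I * (Real.pi : ℂ) / 4)) =
      Complex.exp (-(Complex.I * (Real.pi : ℂ) / 4)) by
        rw [Complex.star_def, ← Complex.exp_conj]
        congr 1
        simp [neg_div, map_ofNat], ← Complex.exp_add]
    simp
  · simp

theorem resetMatrix_conj (a : ι) (b : Bool) (X : Op (ι → Bool)) (s s' : ι → Bool) :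
    (resetMatrix a b * X * (resetMatrix a b)ᴴ) s s' =
      if s a = false ∧ s' a = false then X (Function.update s a b) (Function.update s' a b)
      else 0 := by
  have key : ∀ s x : ι → Bool, resetMatrix a b s x =
      if x = Function.update s a b then (if s a = false then 1 else 0) else 0 := by
    intro s x
    rw [resetMatrix, of_apply, ← ite_and]
    congr 1
    refine propext ⟨?_, ?_⟩
    · rintro ⟨rfl, rfl⟩
      simp
    · rintro ⟨rfl, h⟩
      simp [← h]
  simp only [mul_apply, conjTranspose_apply, key]
  by_cases h : s a = false <;> by_cases h' : s' a = false <;> simp [h, h']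

theorem reset_apply (a : ι) (X : Op (ι → Bool)) (s s' : ι → Bool) :
    (Gate.reset a).apply X s s' = if s a = false ∧ s' a = false then
      ∑ b, X (Function.update s a b) (Function.update s' a b) else 0 := by
  simp only [Gate.apply, Gate.kraus, List.map_cons, List.map_nil, List.sum_cons, List.sum_nil,
    add_zero, Matrix.add_apply, resetMatrix_conj, Fintype.sum_bool]
  split_ifs
  · rw [add_comm]
  · simp

/-- Exchanging qubit `a` with an external bit is an involution on pairs. This is the counting behind
trace preservation of a reset and behind the clearing of ciphertext qubits. -/
theorem sum_update_swap {β : Type} [AddCommMonoid β] (a : ι) (h : (ι → Bool) → Bool → β) :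
    ∑ x, ∑ b, h (Function.update x a b) (x a) = ∑ b, ∑ x, h x b := by
  rw [Finset.sum_comm (γ := Bool)]
  rw [← Fintype.sum_prod_type' (f := fun x b => h (Function.update x a b) (x a)),
    ← Fintype.sum_prod_type' (f := fun x b => h x b)]
  have hinv : Function.Involutive fun p : (ι → Bool) × Bool =>
      (Function.update p.1 a p.2, p.1 a) := by
    rintro ⟨x, b⟩
    simp
  exact Fintype.sum_equiv hinv.toPerm _ _ fun p => rfl

theorem sum_reset {β : Type} [AddCommMonoid β] (a : ι) (h : (ι → Bool) → β) :
    ∑ x : ι → Bool, (if x a = false then ∑ b, h (Function.update x a b) else 0) = ∑ x, h x := by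
  have := sum_update_swap a fun x b => if b = false then h x else 0
  simp only [Fintype.sum_bool, reduceCtorEq, if_false, if_true, Finset.sum_const_zero,
    zero_add] at this
  rw [← this]
  refine Finset.sum_congr rfl fun x _ => ?_
  split_ifs <;> simp

theorem TP.gate (g : Gate ι) : TP g.apply := by
  have h1 : ∀ {M : Op (ι → Bool)}, Mᴴ * M = 1 → ∀ X : Op (ι → Bool),
      (([M].map fun K => K * X * Kᴴ).sum).trace = X.trace := by
    intro M hM X
    simp [trace_conj hM]
  cases g with
  | not a => exact h1 (mapMatrix_unitary (Function.Involutive.injective fun x => by simp))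
  | had a => exact h1 (hadMatrix_unitary a)
  | tee a => exact h1 (teeMatrix_unitary a)
  | cnot a b =>
    refine h1 (mapMatrix_unitary (Function.Involutive.injective fun x => ?_))
    by_cases h : a ≠ b ∧ x a = true
    · simp [h]
    · simp only [if_neg h]
  | toffoli a b c =>
    refine h1 (mapMatrix_unitary (Function.Involutive.injective fun x => ?_))
    by_cases h : a ≠ c ∧ b ≠ c ∧ x a = true ∧ x b = true
    · simp [h]
    · simp only [if_neg h]
  | reset a =>
    intro X
    simp only [Matrix.trace, Matrix.diag, reset_apply, and_self]
    exact sum_reset a fun x => X x x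

theorem TP.runGates (gs : List (Gate ι)) : TP (runGates gs) := by
  induction gs with
  | nil => exact fun _ => rfl
  | cons g gs ih => exact ih.comp (TP.gate g)

theorem mapMatrix_conj {β : Type} [Fintype β] [DecidableEq β] {f : β → β}
    (hf : Function.Involutive f) (X : Op β) (s s' : β) :
    (mapMatrix f * X * (mapMatrix f)ᴴ) s s' = X (f s) (f s') := by
  have key : ∀ s x : β, mapMatrix f s x = if x = f s then 1 else 0 := by
    intro s x
    rw [mapMatrix, of_apply]
    congr 1
    exact propext ⟨fun h => by rw [h, hf], fun h => by rw [h, hf]⟩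
  simp [mul_apply, key]

end

/-! ## The trace norm -/

section
variable {α : Type} [Fintype α] [DecidableEq α]

/-- Let the columns of `U` be orthonormal eigenvectors of Z†Z. Then W = ZU has the singular values
as column norms, Z = WU†, and Cauchy–Schwarz column by column bounds the diagonal of Z. -/
theorem sum_diag_le_traceNorm (s : Finset α) (Z : Op α) :
    |∑ a ∈ s, (Z a a).re| ≤ traceNorm Z := by
  set hA := isHermitian_conjTranspose_mul_self Z
  set U : Op α := (hA.eigenvectorUnitary : Op α)
  have hU : U * Uᴴ = 1 := Unitary.coe_mul_star_self hA.eigenvectorUnitary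
  have hU' : Uᴴ * U = 1 := Unitary.coe_star_mul_self hA.eigenvectorUnitary
  set W := Z * U
  have hW : Wᴴ * W = diagonal fun i => (hA.eigenvalues i : ℂ) := by
    have h := hA.conjStarAlgAut_star_eigenvectorUnitary
    rw [Unitary.conjStarAlgAut_star_apply] at h
    rw [conjTranspose_mul, ← Matrix.mul_assoc, Matrix.mul_assoc Uᴴ]
    exact h
  have hnorm : ∀ (M : Op α) (i : α), (Mᴴ * M) i i = ((∑ a, ‖M a i‖ ^ 2 : ℝ) : ℂ) := by
    intro M i
    simp [mul_apply, conjTranspose_apply, Complex.conj_mul']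
  have hWn : ∀ i, ∑ a, ‖W a i‖ ^ 2 = hA.eigenvalues i := by
    intro i
    have := hnorm W i
    rw [hW, diagonal_apply_eq] at this
    exact_mod_cast this.symm
  have hUn : ∀ i, ∑ a, ‖U a i‖ ^ 2 = 1 := by
    intro i
    have := hnorm U i
    rw [hU', one_apply_eq] at this
    exact_mod_cast this.symm
  have hZ : Z = W * Uᴴ := by rw [Matrix.mul_assoc, hU, Matrix.mul_one]
  calc |∑ a ∈ s, (Z a a).re| ≤ ∑ a ∈ s, |(Z a a).re| := Finset.abs_sum_le_sum_abs _ _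
    _ ≤ ∑ a, ∑ i, ‖W a i‖ * ‖U a i‖ := by
        refine (Finset.sum_le_univ_sum_of_nonneg fun a => abs_nonneg _).trans
          (Finset.sum_le_sum fun a _ => (Complex.abs_re_le_norm _).trans ?_)
        conv_lhs => rw [hZ, mul_apply]
        refine (norm_sum_le _ _).trans (Finset.sum_le_sum fun i _ => ?_)
        simp
    _ = ∑ i, ∑ a, ‖W a i‖ * ‖U a i‖ := Finset.sum_comm
    _ ≤ traceNorm Z := Finset.sum_le_sum fun i _ => by
        have := Finset.sum_mul_sq_le_sq_mul_sq Finset.univ (fun a => ‖W a i‖) fun a => ‖U a i‖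
        rw [hWn, hUn, mul_one] at this
        exact Real.le_sqrt_of_sq_le this

theorem traceNorm_posSemidef {Y : Op α} (hY : Y.PosSemidef) : traceNorm Y = Y.trace.re := by
  set hA := isHermitian_conjTranspose_mul_self Y
  set U : Op α := (hA.eigenvectorUnitary : Op α)
  have hU : U * Uᴴ = 1 := Unitary.coe_mul_star_self hA.eigenvectorUnitary
  have hU' : Uᴴ * U = 1 := Unitary.coe_star_mul_self hA.eigenvectorUnitary
  have hpos : ∀ i, 0 ≤ hA.eigenvalues i :=
    (posSemidef_conjTranspose_mul_self Y).eigenvalues_nonneg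
  have hYU : Y * U = U * diagonal fun i => (Real.sqrt (hA.eigenvalues i) : ℂ) := by
    ext a i
    rw [mul_diagonal]
    set s := Real.sqrt (hA.eigenvalues i)
    set u : α → ℂ := fun a => U a i
    have hu : Y *ᵥ (Y *ᵥ u) = ((s : ℂ) * s) • u := by
      have h : (Yᴴ * Y) *ᵥ u = (hA.eigenvalues i : ℂ) • u := hA.mulVec_eigenvectorBasis i
      have hs : ((s : ℂ) * s) = (hA.eigenvalues i : ℂ) := by
        rw [← Complex.ofReal_mul, Real.mul_self_sqrt (hpos i)]
      rw [hs, ← h, mulVec_mulVec]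
      conv_rhs => rw [hY.1.eq]
    -- Here Y²u = s²u, so v = (Y − s)u satisfies Yv = −sv. For s > 0 this contradicts Y ≥ 0 unless v
    -- = 0; for s = 0 it follows from ⟨Yu, Yu⟩ = ⟨u, Y²u⟩ = 0. Thus eigenvectors of Y†Y are
    -- eigenvectors of Y for the square root.
    set v := Y *ᵥ u - (s : ℂ) • u
    have hv : Y *ᵥ v = -(s : ℂ) • v := by
      simp only [v, mulVec_sub, mulVec_smul, hu, smul_sub, smul_smul, neg_mul, neg_smul]
      rw [sub_neg_eq_add, neg_add_eq_sub]
    have h1 := hY.dotProduct_mulVec_nonneg v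
    rw [hv, dotProduct_smul, smul_eq_mul] at h1
    have h2 : 0 ≤ star v ⬝ᵥ v := dotProduct_star_self_nonneg v
    have hz : v = 0 := by
      rcases (Real.sqrt_nonneg (hA.eigenvalues i)).eq_or_lt with h0 | h0
      · have hs : (s : ℂ) = 0 := by exact_mod_cast h0.symm
        have hv' : v = Y *ᵥ u := by simp [v, hs]
        rw [← dotProduct_star_self_eq_zero (v := v)]
        conv_lhs => rw [hv']
        rw [star_mulVec, hY.1.eq, ← dotProduct_mulVec, hu, hs]
        simp
      · rw [← dotProduct_star_self_eq_zero (v := v)]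
        refine le_antisymm ?_ h2
        have hs : (0 : ℂ) < s := by exact_mod_cast h0
        by_contra hc
        have hp : 0 < star v ⬝ᵥ v := lt_of_le_of_ne h2 fun h => hc h.symm.le
        have := mul_pos hs hp
        rw [neg_mul] at h1
        exact absurd (neg_nonneg.mp h1) (not_le_of_gt this)
    have := congrFun (sub_eq_zero.mp hz) a
    rw [mul_apply]
    rw [Pi.smul_apply, smul_eq_mul, mul_comm] at this
    exact this
  have : Y.trace = ((∑ i, Real.sqrt (hA.eigenvalues i) : ℝ) : ℂ) := by
    have h : Y = Y * U * Uᴴ := by rw [Matrix.mul_assoc, hU, Matrix.mul_one]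
    conv_lhs => rw [h]
    rw [hYU, Matrix.trace_mul_comm, ← Matrix.mul_assoc, hU', Matrix.one_mul, trace_diagonal]
    push_cast
    rfl
  rw [this, Complex.ofReal_re]
  rfl

end

/-- A one-dimensional ancilla is enough here: the trace norm bounds every partial diagonal sum. -/
theorem DiamondLE.sum_diag_le {α β : Type} [Fintype α] [DecidableEq α] [Fintype β]
    [DecidableEq β] {Φ : Op α → Op β} {ε : ℝ} (h : DiamondLE Φ ε) {Y : Op α}
    (hY : Y.PosSemidef) (h1 : Y.trace.re ≤ 1) (s : Finset β) :
    |∑ b ∈ s, (Φ Y b b).re| ≤ ε := by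
  have hX : (Y.submatrix Prod.fst Prod.fst : Op (α × Fin 1)).PosSemidef := hY.submatrix _
  have h2 := h 1 (Y.submatrix Prod.fst Prod.fst) (by
    rw [traceNorm_posSemidef hX]
    simpa [Matrix.trace, Fintype.sum_prod_type] using h1)
  refine le_trans ?_ h2
  have := sum_diag_le_traceNorm (s ×ˢ Finset.univ)
    (tensorId Φ (Y.submatrix Prod.fst Prod.fst : Op (α × Fin 1)))
  rw [Finset.sum_product] at this
  simp only [Finset.univ_unique, Finset.sum_singleton] at this
  exact this

/-! ## Resetting and conditionally clearing registers -/

theorem runGates_append {ι : Type} [Fintype ι] [DecidableEq ι] (gs hs : List (Gate ι))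
    (X : Op (ι → Bool)) : runGates (gs ++ hs) X = runGates hs (runGates gs X) :=
  List.foldl_append

theorem runGates_cons {ι : Type} [Fintype ι] [DecidableEq ι] (g : Gate ι) (gs : List (Gate ι))
    (X : Op (ι → Bool)) : runGates (g :: gs) X = runGates gs (g.apply X) := rfl

/-- The disjunction is the induction invariant: either qubit `i` is still to be reset, or it is
already in state 0, which resets of other qubits preserve. -/
theorem runGates_reset_eq_zero {ι : Type} [Fintype ι] [DecidableEq ι] {l : List ι} {i : ι}
    (Y : Op (ι → Bool)) {s s' : ι → Bool} (hs : ¬(s i = false ∧ s' i = false))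
    (h : i ∈ l ∨ ∀ s s' : ι → Bool, ¬(s i = false ∧ s' i = false) → Y s s' = 0) :
    runGates (l.map Gate.reset) Y s s' = 0 := by
  induction l generalizing Y with
  | nil =>
    rcases h with h | h
    · simp at h
    · exact h _ _ hs
  | cons a l ih =>
    rw [List.map_cons, runGates_cons]
    by_cases hl : i ∈ l
    · exact ih _ (.inl hl)
    · refine ih _ (.inr fun t t' ht => ?_)
      rw [reset_apply]
      split_ifs with h0
      · by_cases ha : i = a
        · exact absurd (ha ▸ h0) ht
        · refine Finset.sum_eq_zero fun b _ => ?_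
          have h' := h.resolve_left (by simp [ha, hl])
          refine h' _ _ ?_
          rwa [Function.update_of_ne ha, Function.update_of_ne ha]
      · rfl

/-- Only the entry at `zeros` can survive, and trace preservation determines it. -/
theorem runGates_reset_all {n : ℕ} (Y : Op (Bits n)) :
    runGates ((List.finRange n).map Gate.reset) Y = Y.trace • ketbra zeros := by
  set R := runGates ((List.finRange n).map Gate.reset) Y with hR
  have h0 : ∀ s s' : Bits n, ¬(s = zeros ∧ s' = zeros) → R s s' = 0 := by
    intro s s' h
    by_contra hne
    refine h ⟨?_, ?_⟩ <;> funext i <;> by_contra hi <;>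
      exact hne (runGates_reset_eq_zero (i := i) Y (fun hc => hi (by simp [hc, zeros]))
        (.inl (List.mem_finRange i)))
  have htr : R zeros zeros = Y.trace := by
    rw [← TP.runGates ((List.finRange n).map Gate.reset) Y, ← hR, Matrix.trace]
    symm
    exact Finset.sum_eq_single zeros (fun s _ hs => h0 s s fun h => hs h.1) (by simp)
  ext s s'
  by_cases h : s = zeros ∧ s' = zeros
  · rw [h.1, h.2, htr]
    simp [ketbra]
  · rw [h0 s s' h, ketbra, Matrix.smul_apply, Matrix.single_apply,
      if_neg fun hc => h ⟨hc.1.symm, hc.2.symm⟩, smul_zero]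

/-! ### The registers of an adversary and their conditional states -/

section
variable {m c w : ℕ}

/-- The basis label of an adversary's qubits with given contents of the registers. -/
def label (a : Bits m) (z : Bits c) (e : Bits (w + 1)) : AdvWire m c w → Bool :=
  Sum.elim a (Sum.elim z e)

theorem update_label_plain (a : Bits m) (z : Bits c) (e : Bits (w + 1)) (i : Fin m) (b : Bool) :
    Function.update (label a z e) (.inl i) b = label (Function.update a i b) z e := by
  rw [label, Sum.update_elim_inl, label]

theorem update_label_cipher (a : Bits m) (z : Bits c) (e : Bits (w + 1)) (i : Fin c) (b : Bool) :
    Function.update (label a z e) (.inr (.inl i)) b = label a (Function.update z i b) e := by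
  rw [label, Sum.update_elim_inr, Sum.update_elim_inl, label]

theorem update_label_work (a : Bits m) (z : Bits c) (e : Bits (w + 1)) (i : Fin (w + 1))
    (b : Bool) :
    Function.update (label a z e) (.inr (.inr i)) b = label a z (Function.update e i b) := by
  rw [label, Sum.update_elim_inr, Sum.update_elim_inr, label]

theorem label_eta (s : AdvWire m c w → Bool) :
    label (fun i => s (.inl i)) (fun i => s (.inr (.inl i))) (fun i => s (.inr (.inr i))) = s := by
  ext (i | i | i) <;> rfl

theorem sum_label {β : Type} [AddCommMonoid β] (f : (AdvWire m c w → Bool) → β) :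
    ∑ s, f s = ∑ e, ∑ a, ∑ z, f (label a z e) := by
  let E : (AdvWire m c w → Bool) ≃ Bits (w + 1) × Bits m × Bits c :=
    { toFun := fun s => (fun i => s (.inr (.inr i)), fun i => s (.inl i), fun i => s (.inr (.inl i)))
      invFun := fun p => label p.2.1 p.2.2 p.1
      left_inv := label_eta
      right_inv := fun _ => rfl }
  rw [← E.symm.sum_comp, Fintype.sum_prod_type]
  refine Finset.sum_congr rfl fun e _ => ?_
  rw [Fintype.sum_prod_type]
  rfl

/-- The part of an operator that a challenger gets to see through the plaintext register, for given
contents of the work space and of the memory. -/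
def plainBlock {ε : Type} (X : Op ((AdvWire m c w → Bool) × ε)) (p q : Bits (w + 1) × ε) :
    Op (Bits m) :=
  Matrix.of fun a a' => ∑ z : Bits c, X (label a z p.1, p.2) (label a' z q.1, q.2)

theorem oracleCall_eq {ε ε' : Type} (Φ : Op (Bits m × ε) → Op (Bits c × ε'))
    (X : Op ((AdvWire m c w → Bool) × ε)) :
    oracleCall Φ X = Matrix.of fun p q =>
      if (fun i => p.1 (.inl i)) = (zeros : Bits m) ∧
          (fun i => q.1 (.inl i)) = (zeros : Bits m) then
        Φ (Matrix.of fun a a' => plainBlock X (fun i => p.1 (.inr (.inr i)), a.2)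
            (fun i => q.1 (.inr (.inr i)), a'.2) a.1 a'.1)
          (fun i => p.1 (.inr (.inl i)), p.2) (fun i => q.1 (.inr (.inl i)), q.2)
      else 0 := rfl

theorem plainBlock_reset {ε : Type} (i : Fin m) (X : Op ((AdvWire m c w → Bool) × ε))
    (p q : Bits (w + 1) × ε) :
    plainBlock (tensorId (Gate.reset (.inl i)).apply X) p q =
      (Gate.reset i).apply (plainBlock X p q) := by
  ext a a'
  simp only [plainBlock, tensorId, of_apply, reset_apply, update_label_plain]
  by_cases h : a i = false ∧ a' i = false
  · rw [if_pos h]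
    exact (Finset.sum_congr rfl fun z _ => if_pos h).trans Finset.sum_comm
  · rw [if_neg h]
    exact Finset.sum_eq_zero fun z _ => if_neg h

theorem plainBlock_resets {ε : Type} (l : List (Fin m)) (X : Op ((AdvWire m c w → Bool) × ε))
    (p q : Bits (w + 1) × ε) :
    plainBlock (tensorId (runGates (l.map fun i => Gate.reset (.inl i))) X) p q =
      runGates (l.map Gate.reset) (plainBlock X p q) := by
  induction l generalizing X with
  | nil => rfl
  | cons i l ih =>
    rw [List.map_cons, List.map_cons, runGates_cons, ← plainBlock_reset, ← ih]
    rfl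

theorem plainBlock_resetAll {ε : Type} (X : Op ((AdvWire m c w → Bool) × ε))
    (p q : Bits (w + 1) × ε) :
    plainBlock (tensorId (runGates ((List.finRange m).map fun i => Gate.reset (.inl i))) X) p q =
      (plainBlock X p q).trace • ketbra zeros := by
  rw [plainBlock_resets, runGates_reset_all]

/-- Sending the reset plaintext register to a memoryless challenger amounts to replacing the
plaintext by `|0…0⟩`. -/
theorem oracleCall_resetAll (Φ : Op (Bits m) → Op (Bits c))
    (X : Op ((AdvWire m c w → Bool) × Unit)) :
    oracleCall (ε' := Unit) (tensorId Φ)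
        (tensorId (runGates ((List.finRange m).map fun i => Gate.reset (.inl i))) X) =
      oracleCall (tensorId fun Y => Φ (Y.trace • ketbra zeros)) X := by
  rw [oracleCall_eq, oracleCall_eq]
  simp only [plainBlock_resetAll]
  rfl

/-- This trace is all that the cheat-detecting oracle uses of the plaintext register. -/
theorem sum_plainBlock_resetAll {ε : Type} (X : Op ((AdvWire m c w → Bool) × ε))
    (p q : Bits (w + 1) × ε) :
    ∑ a, plainBlock
        (tensorId (runGates ((List.finRange m).map fun i => Gate.reset (.inl i))) X) p q a a =
      ∑ a, plainBlock X p q a a := by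
  rw [plainBlock_resetAll]
  have h := trace_smul (plainBlock X p q).trace (ketbra (zeros : Bits m))
  rw [ketbra, Matrix.trace_single_eq_same, smul_eq_mul, mul_one] at h
  exact h

/-- The state of the plaintext register when the first qubit of the work space is `β`. -/
def plainIf (β : Bool) (X : Op ((AdvWire m c w → Bool) × Unit)) : Op (Bits m) :=
  ∑ e : Bits (w + 1), if e 0 = β then plainBlock X (e, ()) (e, ()) else 0

/-- The state of the ciphertext register when the first qubit of the work space is `β`. -/
def cipherIf (β : Bool) (X : Op ((AdvWire m c w → Bool) × Unit)) : Op (Bits c) :=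
  Matrix.of fun z z' => ∑ e : Bits (w + 1), if e 0 = β then
    ∑ a : Bits m, X (label a z e, ()) (label a z' e, ()) else 0

/-- The call leaves the work space alone, so conditioning on its first qubit commutes with it; the
plaintext register comes back as zeros, hence only that label contributes. -/
theorem cipherIf_oracleCall {Φ : Op (Bits m) → Op (Bits c)} (hΦ : CP Φ) (β : Bool)
    (X : Op ((AdvWire m c w → Bool) × Unit)) :
    cipherIf β (oracleCall (tensorId Φ) X) = Φ (plainIf β X) := by
  rw [plainIf, hΦ.sum_map]
  ext z z'
  rw [Matrix.sum_apply, cipherIf, of_apply]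
  refine Finset.sum_congr rfl fun e _ => ?_
  split_ifs
  · rw [Finset.sum_eq_single (zeros : Bits m)]
    · rw [oracleCall_eq, of_apply, if_pos ⟨rfl, rfl⟩]
      rfl
    · intro a _ ha
      rw [oracleCall_eq, of_apply, if_neg fun h => ha h.1]
    · simp
  · rw [hΦ.zero_map, Matrix.zero_apply]

theorem ptrace_ciphertextPart (X : Op ((AdvWire m c w → Bool) × Unit)) :
    (ptrace Prod.fst Prod.snd (ciphertextPart X) : Op (Bits c)) =
      cipherIf false X + cipherIf true X := by
  ext z z'
  have h1 : ∀ (Y : Op (Bits c × Unit)), (ptrace Prod.fst Prod.snd Y : Op (Bits c)) z z' =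
      Y (z, ()) (z', ()) := by
    intro Y
    simp only [ptrace, of_apply, Fintype.sum_prod_type, Finset.univ_unique,
      Finset.sum_singleton, and_true]
    rw [Finset.sum_eq_single z (fun b _ hb => Finset.sum_eq_zero fun _ _ => if_neg fun h => hb h.1)
      (by simp), Finset.sum_eq_single z' (fun b _ hb => if_neg fun h => hb h.2) (by simp)]
    simp
  rw [h1, Matrix.add_apply]
  simp only [cipherIf, of_apply, ← Finset.sum_add_distrib]
  simp only [ciphertextPart, ptrace, of_apply, Fintype.sum_prod_type, Finset.univ_unique,
    Finset.sum_singleton, sum_label]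
  refine Finset.sum_congr rfl fun e _ => ?_
  have h2 : ((if e 0 = false then ∑ a : Bits m, X (label a z e, ()) (label a z' e, ()) else 0) +
      if e 0 = true then ∑ a : Bits m, X (label a z e, ()) (label a z' e, ()) else 0) =
      ∑ a : Bits m, X (label a z e, ()) (label a z' e, ()) := by
    cases e 0 <;> simp
  rw [h2]
  refine Finset.sum_congr rfl fun a _ => ?_
  rw [Finset.sum_eq_single z, Finset.sum_eq_single e, Finset.sum_eq_single a,
    Finset.sum_eq_single z']
  · exact if_pos ⟨rfl, rfl, rfl⟩
  · exact fun b _ hb => if_neg fun h => hb (congrArg Prod.fst h.2.1)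
  · simp
  · exact fun b _ hb => Finset.sum_eq_zero fun _ _ => if_neg fun h =>
      hb (congrArg Prod.fst h.2.2).symm
  · simp
  · exact fun b _ hb => Finset.sum_eq_zero fun _ _ => Finset.sum_eq_zero fun _ _ =>
      if_neg fun h => hb (congrArg Prod.snd h.2.2).symm
  · simp
  · exact fun b _ hb => Finset.sum_eq_zero fun _ _ => Finset.sum_eq_zero fun _ _ =>
      Finset.sum_eq_zero fun _ _ => if_neg fun h => hb (congrArg Prod.fst h.1)
  · simp

theorem trace_plainIf (β : Bool) (X : Op ((AdvWire m c w → Bool) × Unit)) :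
    (plainIf β X).trace = ∑ s : AdvWire m c w → Bool,
      if s (.inr (.inr 0)) = β then X (s, ()) (s, ()) else 0 := by
  rw [plainIf, Matrix.trace_sum, sum_label]
  refine Finset.sum_congr rfl fun e _ => ?_
  have : ∀ a z, (label a z e : AdvWire m c w → Bool) (.inr (.inr 0)) = e 0 := fun _ _ => rfl
  simp only [this]
  split_ifs
  · rfl
  · simp

theorem outputOne_eq (X : Op ((AdvWire m c w → Bool) × Unit)) :
    outputOne X = (plainIf true X).trace.re := by
  rw [trace_plainIf, Complex.re_sum, outputOne, Fintype.sum_prod_type]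
  refine Finset.sum_congr rfl fun s _ => ?_
  rw [Finset.univ_unique, Finset.sum_singleton]
  split_ifs <;> rfl

theorem trace_plainIf_add (X : Op ((AdvWire m c w → Bool) × Unit)) :
    (plainIf false X).trace + (plainIf true X).trace = X.trace := by
  rw [trace_plainIf, trace_plainIf, ← Finset.sum_add_distrib, Matrix.trace,
    Fintype.sum_prod_type]
  refine Finset.sum_congr rfl fun s _ => ?_
  rw [Finset.univ_unique, Finset.sum_singleton]
  cases s (.inr (.inr 0)) <;> simp

theorem plainIf_posSemidef (β : Bool) {X : Op ((AdvWire m c w → Bool) × Unit)}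
    (hX : X.PosSemidef) : (plainIf β X).PosSemidef := by
  refine posSemidef_sum _ fun e _ => ?_
  split_ifs
  · have : plainBlock X (e, ()) (e, ()) =
        ∑ z : Bits c, X.submatrix (fun a => (label a z e, ())) fun a => (label a z e, ()) := by
      ext a a'
      simp [plainBlock, Matrix.sum_apply]
    rw [this]
    exact posSemidef_sum _ fun z _ => hX.submatrix _
  · exact PosSemidef.zero

theorem plainIf_not (β : Bool) (X : Op ((AdvWire m c w → Bool) × Unit)) :
    plainIf β (tensorId (Gate.not (.inr (.inr 0))).apply X) = plainIf (!β) X := by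
  have hinv : Function.Involutive
      (fun e => Function.update e 0 (!e 0) : Bits (w + 1) → Bits (w + 1)) := fun e => by simp
  let σ : Equiv.Perm (Bits (w + 1)) := Function.Involutive.toPerm _ hinv
  rw [plainIf, plainIf, ← Equiv.sum_comp σ]
  refine Finset.sum_congr rfl fun e _ => ?_
  have h1 : σ e 0 = !e 0 := by
    change Function.update e 0 (!e 0) 0 = _
    simp
  have h2 : plainBlock (tensorId (Gate.not (.inr (.inr 0))).apply X)
      (σ e, ()) (σ e, ()) = plainBlock X (e, ()) (e, ()) := by
    ext a a'
    simp only [plainBlock, of_apply, tensorId, Gate.apply, Gate.kraus, List.map_cons,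
      List.map_nil, List.sum_cons, List.sum_nil, add_zero]
    refine Finset.sum_congr rfl fun z _ => ?_
    rw [mapMatrix_conj (fun x => by simp)]
    have h3 : ∀ a : Bits m, Function.update (label a z (σ e)) (.inr (.inr 0))
        (!(label a z (σ e) : AdvWire m c w → Bool) (.inr (.inr 0))) = label a z e := by
      intro a
      rw [update_label_work]
      exact congrArg _ (hinv e)
    rw [h3, h3]
    rfl
  rw [h1, h2]
  cases β <;> cases e 0 <;> rfl

/-! ### Controlled clearing of the ciphertext register -/

theorem toffoli_apply {ι : Type} [Fintype ι] [DecidableEq ι] {a b d : ι} (ha : a ≠ d)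
    (hb : b ≠ d) (X : Op (ι → Bool)) (s s' : ι → Bool) :
    (Gate.toffoli a b d).apply X s s' =
      X (Function.update s d (s d ^^ (s a && s b))) (Function.update s' d (s' d ^^ (s' a && s' b))) := by
  have hf : (fun x : ι → Bool => if a ≠ d ∧ b ≠ d ∧ x a = true ∧ x b = true then
      Function.update x d (!x d) else x) = fun x => Function.update x d (x d ^^ (x a && x b)) := by
    funext x
    cases x a <;> cases x b <;> simp [ha, hb]
  simp only [Gate.apply, Gate.kraus, List.map_cons, List.map_nil, List.sum_cons, List.sum_nil,
    add_zero, hf]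
  rw [mapMatrix_conj]
  intro x
  simp [Function.update_of_ne ha, Function.update_of_ne hb]

/-- Gates that set qubit `i` of the ciphertext register to `0` if the first qubit of the work space
is `1`, with the help of qubit `a` of the plaintext register. -/
def clearQubit (a : Fin m) (i : Fin c) : List (Gate (AdvWire m c w)) :=
  [.reset (.inl a), .toffoli (.inr (.inr 0)) (.inr (.inl i)) (.inl a),
    .toffoli (.inr (.inr 0)) (.inl a) (.inr (.inl i))]

/-- If the control is 1, the first Toffoli copies ciphertext bit `i` to the reset qubit `a`, and the
second cancels it at its origin. Read backwards, `x a` is the old ciphertext bit and `b` the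
discarded plaintext bit. Entries diagonal in plaintext and work space suffice, as both are traced
out in the end. -/
theorem runGates_clearQubit (a : Fin m) (i : Fin c) (X : Op (AdvWire m c w → Bool))
    (x : Bits m) (z z' : Bits c) (e : Bits (w + 1)) :
    runGates (clearQubit a i) X (label x z e) (label x z' e) =
      if e 0 = true then
        if z i = false ∧ z' i = false then
          ∑ b, X (label (Function.update x a b) (Function.update z i (x a)) e)
            (label (Function.update x a b) (Function.update z' i (x a)) e)
        else 0
      else
        if x a = false then
          ∑ b, X (label (Function.update x a b) z e) (label (Function.update x a b) z' e)
        else 0 := by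
  have h1 : ∀ (z : Bits c), (label x z e : AdvWire m c w → Bool) (.inr (.inr 0)) = e 0 :=
    fun _ => rfl
  have h2 : ∀ (x : Bits m) (z : Bits c), (label x z e : AdvWire m c w → Bool) (.inl a) = x a :=
    fun _ _ => rfl
  have h3 : ∀ (z : Bits c), (label x z e : AdvWire m c w → Bool) (.inr (.inl i)) = z i :=
    fun _ => rfl
  change Gate.apply _ (Gate.apply _ (Gate.apply _ X)) _ _ = _
  rw [toffoli_apply (by simp) (by simp),
    toffoli_apply (by simp) (by simp), reset_apply]
  simp only [h1, h2, h3, update_label_cipher, update_label_plain, Function.update_self,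
    Function.update_idem]
  cases e 0
  · simp
  · cases hz : z i <;> cases hz' : z' i <;> simp

theorem cipherIf_false_clearQubit (a : Fin m) (i : Fin c)
    (X : Op ((AdvWire m c w → Bool) × Unit)) :
    cipherIf false (tensorId (runGates (clearQubit a i)) X) = cipherIf false X := by
  ext z z'
  simp only [cipherIf, of_apply, tensorId, runGates_clearQubit]
  refine Finset.sum_congr rfl fun e _ => ?_
  by_cases h : e 0 = false
  · simp only [h, if_true, Bool.false_eq_true, if_false]
    exact sum_reset a fun x => X (label x z e, ()) (label x z' e, ())
  · rw [if_neg h, if_neg h]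

theorem cipherIf_true_clearQubit (a : Fin m) (i : Fin c)
    (X : Op ((AdvWire m c w → Bool) × Unit)) :
    cipherIf true (tensorId (runGates (clearQubit a i)) X) =
      (Gate.reset i).apply (cipherIf true X) := by
  ext z z'
  rw [reset_apply]
  simp only [cipherIf, of_apply, tensorId, runGates_clearQubit]
  by_cases h : z i = false ∧ z' i = false
  · rw [if_pos h, Finset.sum_comm]
    refine Finset.sum_congr rfl fun e _ => ?_
    split_ifs
    · exact sum_update_swap a fun x b => X (label x (Function.update z i b) e, ())
        (label x (Function.update z' i b) e, ())
    · simp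
  · rw [if_neg h]
    refine Finset.sum_eq_zero fun e _ => ?_
    split_ifs <;> simp

theorem cipherIf_false_clear (a : Fin m) (l : List (Fin c))
    (X : Op ((AdvWire m c w → Bool) × Unit)) :
    cipherIf false (tensorId (runGates (l.flatMap (clearQubit a))) X) = cipherIf false X := by
  induction l generalizing X with
  | nil => rfl
  | cons i l ih =>
    rw [List.flatMap_cons, funext (runGates_append _ _), tensorId_comp, ih,
      cipherIf_false_clearQubit]

theorem cipherIf_true_clear (a : Fin m) (l : List (Fin c))
    (X : Op ((AdvWire m c w → Bool) × Unit)) :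
    cipherIf true (tensorId (runGates (l.flatMap (clearQubit a))) X) =
      runGates (l.map Gate.reset) (cipherIf true X) := by
  induction l generalizing X with
  | nil => rfl
  | cons i l ih =>
    rw [List.flatMap_cons, funext (runGates_append _ _), tensorId_comp, ih,
      cipherIf_true_clearQubit]
    rfl

end

/-! ## Channels of an encryption scheme -/

section
variable {κ m c w : ℕ}

theorem CP.encChannel (gs : List (Gate (EncWire κ m c w))) (k : Bits κ) :
    CP (encChannel gs k) :=
  (CP.ptrace _ _).comp ((CP.runGates gs).comp (CP.prepare _))

theorem TP.encChannel (gs : List (Gate (EncWire κ m c w))) (k : Bits κ) :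
    TP (encChannel gs k) := by
  refine (TP.ptrace ?_).comp ((TP.runGates gs).comp (TP.prepare ?_))
  · intro s s' h h'
    simp only [Prod.mk.injEq] at h'
    ext (i | i | i | i)
    exacts [congrFun h'.1 i, congrFun h'.2.1 i, congrFun h i, congrFun h'.2.2 i]
  · intro x x' h
    funext i
    exact congrFun h (.inr (.inl i))

/-- The probability that decryption does not return `⊥`. -/
noncomputable def acceptProb (gs : List (Gate (DecWire κ c m w))) (k : Bits κ) (Y : Op (Bits c)) :
    ℝ :=
  ∑ x : Bits m, (decChannel gs k Y (some x) (some x)).re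

/-- Acceptance is read off a completely positive map before the flag is measured; linearity and
positivity of `acceptProb` follow from this. -/
theorem exists_cp_decChannel (gs : List (Gate (DecWire κ c m w))) (k : Bits κ) :
    ∃ Φ : Op (Bits c) → Op (Bits m × Bool), CP Φ ∧
      ∀ Y x, decChannel gs k Y (some x) (some x) = Φ Y (x, true) (x, true) :=
  ⟨_, (CP.ptrace _ _).comp ((CP.runGates gs).comp (CP.prepare _)), fun _ _ => rfl⟩

theorem acceptProb_add (gs : List (Gate (DecWire κ c m w))) (k : Bits κ) (Y Y' : Op (Bits c)) :
    acceptProb gs k (Y + Y') = acceptProb gs k Y + acceptProb gs k Y' := by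
  obtain ⟨Φ, hΦ, h⟩ := exists_cp_decChannel gs k
  simp only [acceptProb, h, hΦ.add, Matrix.add_apply, Complex.add_re, Finset.sum_add_distrib]

theorem acceptProb_smul (gs : List (Gate (DecWire κ c m w))) (k : Bits κ) (r : ℝ)
    (Y : Op (Bits c)) : acceptProb gs k ((r : ℂ) • Y) = r * acceptProb gs k Y := by
  obtain ⟨Φ, hΦ, h⟩ := exists_cp_decChannel gs k
  simp only [acceptProb, h, hΦ.smul, Matrix.smul_apply, smul_eq_mul, Complex.re_ofReal_mul,
    Finset.mul_sum]

theorem acceptProb_nonneg (gs : List (Gate (DecWire κ c m w))) (k : Bits κ) {Y : Op (Bits c)}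
    (hY : Y.PosSemidef) : 0 ≤ acceptProb gs k Y := by
  obtain ⟨Φ, hΦ, h⟩ := exists_cp_decChannel gs k
  refine Finset.sum_nonneg fun x _ => ?_
  rw [h]
  exact (Complex.nonneg_iff.mp (hΦ.posSemidef hY).diag_nonneg).1

end

theorem ketbra_posSemidef {α : Type} [Fintype α] [DecidableEq α] (x : α) :
    (ketbra x).PosSemidef := by
  have : ketbra x = diagonal (Pi.single x (1 : ℂ)) := by
    rw [ketbra, Matrix.diagonal_single]
  rw [this]
  refine PosSemidef.diagonal fun i => ?_
  by_cases h : i = x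
  · subst h; simp
  · simp [h]

theorem trace_ketbra {α : Type} [Fintype α] [DecidableEq α] (x : α) :
    (ketbra x).trace = 1 := Matrix.trace_single_eq_same x 1

theorem keyDist_nonneg {κ w : ℕ} (gs : List (Gate (GenWire κ w))) (k : Bits κ) :
    0 ≤ keyDist gs k :=
  (Complex.nonneg_iff.mp (((CP.ptrace _ _).comp (CP.runGates gs)).posSemidef
    (ketbra_posSemidef _)).diag_nonneg).1

theorem sum_keyDist {κ w : ℕ} (gs : List (Gate (GenWire κ w))) : ∑ k, keyDist gs k = 1 := by
  have hinj : ∀ s s' : GenWire κ w → Bool, s ∘ Sum.inl = s' ∘ Sum.inl →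
      s ∘ Sum.inr = s' ∘ Sum.inr → s = s' := by
    intro s s' h h'
    ext (i | i)
    exacts [congrFun h i, congrFun h' i]
  have h := ((TP.ptrace hinj).comp (TP.runGates gs)) (ketbra zeros)
  rw [trace_ketbra] at h
  have := congrArg Complex.re h
  rw [Matrix.trace, Complex.re_sum, Complex.one_re] at this
  exact this

/-! ## Runs with a memoryless challenger -/

section
variable {m c w : ℕ}

theorem oracleCall_posSemidef {Φ : Op (Bits m) → Op (Bits c)} (hΦ : CP Φ)
    {X : Op ((AdvWire m c w → Bool) × Unit)} (hX : X.PosSemidef) :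
    (oracleCall (ε' := Unit) (tensorId Φ) X).PosSemidef := by
  -- `Y` is the input with the ciphertext register traced out, `T` the answer spread over all
  -- plaintext labels, and `D` projects onto the zero plaintext; the call is the compression of `T`
  -- by `D`.
  let Y : Op (Bits m × Bits (w + 1)) := ∑ z : Bits c,
    X.submatrix (fun p => (label p.1 z p.2, ())) fun p => (label p.1 z p.2, ())
  have hY : Y.PosSemidef := posSemidef_sum _ fun z _ => hX.submatrix _
  let T : Op ((AdvWire m c w → Bool) × Unit) := (tensorId Φ Y).submatrix
    (fun p => (fun i => p.1 (.inr (.inl i)), fun i => p.1 (.inr (.inr i))))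
    (fun p => (fun i => p.1 (.inr (.inl i)), fun i => p.1 (.inr (.inr i))))
  have hT : T.PosSemidef := (hΦ.pos Y hY).submatrix _
  let D : Op ((AdvWire m c w → Bool) × Unit) := diagonal fun p =>
    if (fun i => p.1 (.inl i)) = (zeros : Bits m) then 1 else 0
  have : oracleCall (ε' := Unit) (tensorId Φ) X = D * T * Dᴴ := by
    ext p q
    have h1 : T p q = tensorId Φ (Matrix.of fun a a' =>
        plainBlock X (fun i => p.1 (.inr (.inr i)), a.2)
          (fun i => q.1 (.inr (.inr i)), a'.2) a.1 a'.1)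
        (fun i => p.1 (.inr (.inl i)), p.2) (fun i => q.1 (.inr (.inl i)), q.2) := by
      simp only [T, submatrix_apply, tensorId, of_apply]
      congr 2
      ext a a'
      simp [Y, Matrix.sum_apply, plainBlock]
    rw [oracleCall_eq, of_apply, diagonal_conjTranspose, mul_diagonal, diagonal_mul, ← h1]
    by_cases hp : (fun i => p.1 (.inl i)) = (zeros : Bits m) <;>
      by_cases hq : (fun i => q.1 (.inl i)) = (zeros : Bits m) <;> simp [hp, hq]
  rw [this]
  exact hT.mul_mul_conjTranspose_same D

theorem trace_eq_sum_label (X : Op ((AdvWire m c w → Bool) × Unit)) :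
    X.trace = ∑ e, ∑ a, ∑ z, X (label a z e, ()) (label a z e, ()) := by
  rw [Matrix.trace, Fintype.sum_prod_type, sum_label]
  simp only [Finset.univ_unique, Finset.sum_singleton]
  rfl

theorem trace_oracleCall {Φ : Op (Bits m) → Op (Bits c)} (hΦ : TP Φ)
    (X : Op ((AdvWire m c w → Bool) × Unit)) :
    (oracleCall (ε' := Unit) (tensorId Φ) X).trace = X.trace := by
  rw [trace_eq_sum_label, trace_eq_sum_label]
  refine Finset.sum_congr rfl fun e _ => ?_
  rw [Finset.sum_eq_single (zeros : Bits m)]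
  · exact (Finset.sum_congr rfl fun z _ => if_pos ⟨rfl, rfl⟩).trans
      (hΦ (plainBlock X (e, ()) (e, ())))
  · exact fun a _ ha => Finset.sum_eq_zero fun z _ => if_neg fun h => ha h.1
  · simp

theorem runOracle_append {Mem : ℕ → Type}
    (call : ∀ j, Op (Bits m × Mem j) → Op (Bits c × Mem (j + 1)))
    (gs hs : List (OGate (AdvWire m c w))) (s : JointState m c w Mem) :
    runOracle call (gs ++ hs) s = runOracle call hs (runOracle call gs s) :=
  List.foldl_append

theorem runOracle_gates {Mem : ℕ → Type}
    (call : ∀ j, Op (Bits m × Mem j) → Op (Bits c × Mem (j + 1)))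
    (gs : List (Gate (AdvWire m c w))) (s : JointState m c w Mem) :
    runOracle call (gs.map OGate.gate) s = ⟨s.1, tensorId (runGates gs) s.2⟩ := by
  induction gs generalizing s with
  | nil => rfl
  | cons g gs ih => exact ih _

theorem runOracle_query {Mem : ℕ → Type}
    (call : ∀ j, Op (Bits m × Mem j) → Op (Bits c × Mem (j + 1)))
    (hs : List (OGate (AdvWire m c w))) (s : JointState m c w Mem) :
    runOracle call (.query :: hs) s = runOracle call hs ⟨s.1 + 1, oracleCall (call s.1) s.2⟩ :=
  rfl

end

/-- The gates that reset the plaintext register. -/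
def resetPlain (m c w : ℕ) : List (Gate (AdvWire m c w)) :=
  (List.finRange m).map fun i => .reset (.inl i)

/-- The gates that set the ciphertext register to `0` if the first qubit of the work space is `1`
(provided that there is a plaintext qubit that can be used as work space). -/
def clearCipher (m c w : ℕ) : List (Gate (AdvWire m c w)) :=
  if h : 0 < m then (List.finRange c).flatMap (clearQubit ⟨0, h⟩) else []

/-- Produce a valid ciphertext if the first qubit of the work space is `1`, and the fixed state
`|0…0⟩` otherwise. -/
def finish (m c w : ℕ) : List (OGate (AdvWire m c w)) :=
  .gate (.not (.inr (.inr 0))) :: .query :: (clearCipher m c w).map .gate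

namespace SKQES

variable {S : SKQES}

theorem cp_enc (n : ℕ) (k : Bits (S.κ n)) : CP (S.enc n k) := CP.encChannel _ _

theorem tp_enc (n : ℕ) (k : Bits (S.κ n)) : TP (S.enc n k) := TP.encChannel _ _

/-- The joint state is a density operator. -/
def IsDensity {m c w : ℕ} (s : JointState m c w NoMem) : Prop :=
  s.2.PosSemidef ∧ s.2.trace = 1

theorem isDensity_startState (m c w : ℕ) :
    IsDensity (startState m c w () : JointState m c w NoMem) :=
  ⟨ketbra_posSemidef _, trace_ketbra _⟩

theorem isDensity_runOracle (n : ℕ) (k : Bits (S.κ n)) {w : ℕ}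
    (gs : List (OGate (AdvWire (S.m n) (S.c n) w)))
    {s : JointState (S.m n) (S.c n) w NoMem} (hs : IsDensity s) :
    IsDensity (runOracle (S.realCall n k) gs s) := by
  induction gs generalizing s with
  | nil => exact hs
  | cons g gs ih =>
    refine ih ?_
    cases g with
    | gate g => exact ⟨(CP.gate g).pos _ hs.1, ((TP.gate g).tensorId _).trans hs.2⟩
    | query =>
      exact ⟨oracleCall_posSemidef (cp_enc n k) hs.1, (trace_oracleCall (tp_enc n k) _).trans hs.2⟩

/-- Summing the diagonal over the labels other than ⊥ turns the diamond bound into acceptance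
probabilities. Subnormalised ρ are allowed because it is applied to the branch in which the
adversary returns 1. -/
theorem exists_correctness (S : SKQES) : ∃ ε : ℕ → ℝ, Negligible ε ∧
    ∀ n (k : Bits (S.κ n)), S.keyProb n k ≠ 0 → ∀ ρ : Op (Bits (S.m n)), ρ.PosSemidef →
      ρ.trace.re ≤ 1 →
        |acceptProb (S.decCircuit n) k (S.enc n k ρ) - ρ.trace.re| ≤ ε n := by
  obtain ⟨ε, hε, h⟩ := S.correct
  refine ⟨ε, hε, fun n k hk ρ hρ h1 => ?_⟩
  have := (h n k hk).sum_diag_le hρ h1 (Finset.univ.map Function.Embedding.some)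
  rw [Finset.sum_map] at this
  simp only [Function.Embedding.some_apply, Matrix.sub_apply, Complex.sub_re,
    Finset.sum_sub_distrib] at this
  rw [Matrix.trace, Complex.re_sum]
  exact this

/-! ## The reduction -/

/-- The NOT makes the control 1 exactly where the adversary returned 0, so only that branch of the
answer is cleared; encryption preserves the trace, so the branch keeps its weight. -/
theorem ptrace_finish {n : ℕ} (hm : 0 < S.m n) (k : Bits (S.κ n)) {w : ℕ}
    (s : JointState (S.m n) (S.c n) w NoMem) :
    (ptrace Prod.fst Prod.snd
      (ciphertextPart (runOracle (S.realCall n k) (finish _ _ _) s).2) : Op (Bits (S.c n))) =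
      S.enc n k (plainIf true s.2) + (plainIf false s.2).trace • ketbra zeros := by
  rw [ptrace_ciphertextPart, finish]
  have h1 : runOracle (S.realCall n k) (.gate (.not (.inr (.inr 0))) :: .query ::
      (clearCipher (S.m n) (S.c n) w).map OGate.gate) s =
      ⟨s.1 + 1, tensorId (runGates (clearCipher _ _ _)) (oracleCall (tensorId (S.enc n k))
        (tensorId (Gate.not (.inr (.inr 0))).apply s.2))⟩ :=
    runOracle_gates (S.realCall n k) _ _
  rw [h1]
  simp only [clearCipher, dif_pos hm]
  rw [cipherIf_false_clear, cipherIf_true_clear, runGates_reset_all,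
    cipherIf_oracleCall (cp_enc n k), cipherIf_oracleCall (cp_enc n k), tp_enc, plainIf_not,
    plainIf_not]
  rfl

/-- The probability that `|0…0⟩` is accepted as a ciphertext. -/
noncomputable def zeroAccept (S : SKQES) (n : ℕ) : ℝ :=
  ∑ k, S.keyProb n k * acceptProb (S.decCircuit n) k (ketbra zeros)

theorem abs_accept_finish_sub_le {ε : ℕ → ℝ}
    (hε : ∀ n (k : Bits (S.κ n)), S.keyProb n k ≠ 0 → ∀ ρ : Op (Bits (S.m n)), ρ.PosSemidef →
      ρ.trace.re ≤ 1 → |acceptProb (S.decCircuit n) k (S.enc n k ρ) - ρ.trace.re| ≤ ε n)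
    {n : ℕ} (hm : 0 < S.m n) {k : Bits (S.κ n)} (hk : S.keyProb n k ≠ 0) {w : ℕ}
    {s : JointState (S.m n) (S.c n) w NoMem} (hs : IsDensity s) :
    |acceptProb (S.decCircuit n) k (ptrace Prod.fst Prod.snd
      (ciphertextPart (runOracle (S.realCall n k) (finish _ _ _) s).2)) - outputOne s.2| ≤
      ε n + acceptProb (S.decCircuit n) k (ketbra zeros) := by
  have h0 := Complex.nonneg_iff.mp (plainIf_posSemidef false hs.1).trace_nonneg
  have h1 := Complex.nonneg_iff.mp (plainIf_posSemidef true hs.1).trace_nonneg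
  have hsum : (plainIf false s.2).trace.re + (plainIf true s.2).trace.re = 1 := by
    rw [← Complex.add_re, trace_plainIf_add, hs.2, Complex.one_re]
  have hre : (plainIf false s.2).trace = ((plainIf false s.2).trace.re : ℂ) :=
    Complex.ext rfl h0.2.symm
  have hJ := acceptProb_nonneg (S.decCircuit n) k (ketbra_posSemidef (zeros : Bits (S.c n)))
  have hc := hε n k hk _ (plainIf_posSemidef true hs.1) (by linarith [h0.1])
  rw [ptrace_finish hm, outputOne_eq, acceptProb_add, hre, acceptProb_smul]
  have h2 := mul_le_of_le_one_left hJ (by linarith [h1.1] : (plainIf false s.2).trace.re ≤ 1)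
  have h3 := mul_nonneg h0.1 hJ
  rw [abs_le] at hc ⊢
  constructor <;> linarith [hc.1, hc.2]

theorem ptrace_startState (m c w : ℕ) :
    (ptrace Prod.fst Prod.snd (ciphertextPart (ketbra ((zeros, ()) :
      (AdvWire m c w → Bool) × Unit))) : Op (Bits c)) = ketbra zeros := by
  have key : ∀ (a : Bits m) (z : Bits c) (e : Bits (w + 1)),
      (label a z e = zeros) ↔ a = zeros ∧ z = zeros ∧ e = zeros := by
    refine fun a z e => ⟨fun h => ⟨?_, ?_, ?_⟩, ?_⟩
    · exact funext fun i => congrFun h (.inl i)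
    · exact funext fun i => congrFun h (.inr (.inl i))
    · exact funext fun i => congrFun h (.inr (.inr i))
    · rintro ⟨rfl, rfl, rfl⟩
      ext (i | i | i) <;> rfl
  rw [ptrace_ciphertextPart]
  ext z z'
  rw [Matrix.add_apply]
  simp only [cipherIf, of_apply, ← Finset.sum_add_distrib]
  rw [Finset.sum_eq_single (zeros : Bits (w + 1))]
  · have h0 : (zeros : Bits (w + 1)) 0 = false := rfl
    rw [if_pos h0, if_neg (by simp [zeros]), add_zero, Finset.sum_eq_single (zeros : Bits m)]
    · simp [ketbra, Matrix.single_apply, key, eq_comm (a := (zeros : AdvWire m c w → Bool)),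
        eq_comm (a := (zeros : Bits c))]
    · intro a _ ha
      simp [ketbra, key, eq_comm (a := (zeros : AdvWire m c w → Bool)), ha]
    · simp
  · intro e _ he
    simp [ketbra, key, eq_comm (a := (zeros : AdvWire m c w → Bool)), he]
  · simp

/-- The forger without instructions. -/
def idleForger (S : SKQES) : S.Forger where
  work _ := 0
  circuit _ := []
  uniform := S.enc_uniform.map (PolyComp.const (.cons .nil .nil))

theorem forgeProb_idleForger (n : ℕ) : forgeProb S.idleForger n = S.zeroAccept n := by
  refine Finset.sum_congr rfl fun k _ => ?_
  simp only [idleForger, runOracle, List.foldl_nil, startState]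
  rw [ptrace_startState]
  rfl

theorem cheatProb_idleForger (D : S.Decomposition) (n : ℕ) : D.cheatProb S.idleForger n = 0 :=
  Finset.sum_eq_zero fun _ _ => mul_eq_zero_of_right _ rfl

end SKQES

/-! ## Uniformity of the reduction -/

theorem PolyTime.append {f g : ℕ → Data} (hf : PolyTime f) (hg : PolyTime g) :
    PolyTime fun n => (f n).append (g n) :=
  (hf.pair hg).map (F := fun x => x.fst.append x.snd)
    (PolyComp.append (PolyComp.fst PolyComp.id) (PolyComp.snd PolyComp.id))

theorem foldSpine_finRange {β : Type} [ToData β] {n : ℕ} (h : Fin n → List β) (G : Data → Data)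
    (g : ℕ → List Data) (hg : ∀ i, (h i).map ToData.toData = g i)
    (hG : ∀ j acc, G (.cons (natToData (j + 1)) (listToData id acc)) =
      listToData id (g j ++ acc)) :
    foldSpine G (natToData n) .nil =
      listToData ToData.toData ((List.finRange n).flatMap h) := by
  have h1 := foldSpine_natToData id G g hG n []
  have h2 := listToData_map id ToData.toData ((List.finRange n).flatMap h)
  simp only [id] at h2
  rw [show (fun a : β => ToData.toData a) = ToData.toData from rfl] at h2
  refine h1.trans (Eq.trans ?_ h2)
  rw [List.append_nil, List.map_flatMap, ← List.map_coe_finRange_eq_range, List.flatMap_map]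
  simp only [hg]

/-- One instruction of `resetPlain`, prepended to a list. -/
def resetPlainStep (x : Data) : Data :=
  .cons (.cons .nil (.cons (natToData 5) (.cons .nil x.fst.snd))) x.snd

/-- The instructions of `clearQubit`, prepended to a list. -/
def clearStep (x : Data) : Data :=
  let f : Data := .cons (.cons .nil .nil) (.cons (.cons .nil .nil) .nil)
  let a : Data := .cons .nil .nil
  let i : Data := .cons (.cons .nil .nil) (.cons .nil x.fst.snd)
  .cons (.cons .nil (.cons (natToData 5) a))
    (.cons (.cons .nil (.cons (natToData 4) (.cons f (.cons i a))))
      (.cons (.cons .nil (.cons (natToData 4) (.cons f (.cons a i)))) x.snd))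

theorem polyTime_resetPlain {m : ℕ → ℕ} (c w : ℕ → ℕ) (hm : PolyTime fun n => natToData (m n)) :
    PolyTime fun n => listToData ToData.toData
      ((resetPlain (m n) (c n) (w n)).map OGate.gate) := by
  have hG : PolyComp resetPlainStep :=
    .cons (.cons .nil (.cons (.const _) (.cons .nil (.snd (.fst .id))))) (.snd .id)
  -- A step adds one instruction with a single index; the constant 20 generously covers its fixed
  -- part.
  have h := hm.map (hG.foldSpine (.X + 20) (fun a l acc => by
    simp only [resetPlainStep, Data.size, Data.fst, Data.snd, natToData, Polynomial.eval_add,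
      Polynomial.eval_X, Polynomial.eval_ofNat]
    omega) .id .nil)
  convert h using 2 with n
  rw [foldSpine_finRange (β := OGate (AdvWire (m n) (c n) (w n)))
    (fun i => [.gate (.reset (.inl i))]) resetPlainStep
    (fun j => [.cons .nil (.cons (natToData 5) (.cons .nil (natToData j)))]) (fun _ => rfl)
    (fun _ _ => rfl), resetPlain, List.map_map, List.map_eq_flatMap]
  rfl

theorem polyTime_clearCipher {m c : ℕ → ℕ} (w : ℕ → ℕ) (hm : PolyTime fun n => natToData (m n))
    (hc : PolyTime fun n => natToData (c n)) :
    PolyTime fun n => listToData ToData.toData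
      ((clearCipher (m n) (c n) (w n)).map OGate.gate) := by
  have hi : PolyComp fun x : Data => .cons (.cons .nil .nil) (.cons .nil x.fst.snd) :=
    .cons (.const _) (.cons .nil (.snd (.fst .id)))
  have hG : PolyComp clearStep :=
    .cons (.const _) (.cons (.cons .nil (.cons (.const _) (.cons (.const _)
      (.cons hi (.const _))))) (.cons (.cons .nil (.cons (.const _) (.cons (.const _)
        (.cons (.const _) hi)))) (.snd .id)))
  -- The index occurs twice in the three instructions of a step, hence `2 * .X`; the case
  -- distinction on the plaintext length mirrors the definition of `clearCipher`.
  have h := (hm.pair hc).map (F := fun x => x.fst.ite (foldSpine clearStep x.snd .nil) .nil)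
    (.ite (.fst .id) (hG.foldSpine (2 * .X + 100) (fun a l acc => by
      simp only [clearStep, Data.size, Data.fst, Data.snd, natToData, Polynomial.eval_add,
        Polynomial.eval_mul, Polynomial.eval_X, Polynomial.eval_ofNat]
      omega) (.snd .id) .nil) .nil)
  convert h using 2 with n
  simp only [Data.fst, Data.snd, clearCipher]
  by_cases h0 : 0 < m n
  · obtain ⟨j, hj⟩ : ∃ j, m n = j + 1 := ⟨m n - 1, by omega⟩
    have h1 : ∀ y z, (natToData (m n)).ite y z = y := by rw [hj]; exact fun _ _ => rfl
    rw [dif_pos h0, h1, List.map_flatMap]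
    exact (foldSpine_finRange (β := OGate (AdvWire (m n) (c n) (w n)))
      (fun i => (clearQubit ⟨0, h0⟩ i).map OGate.gate) clearStep (fun j =>
        let f : Data := .cons (.cons .nil .nil) (.cons (.cons .nil .nil) .nil)
        let a : Data := .cons .nil .nil
        let i : Data := .cons (.cons .nil .nil) (.cons .nil (natToData j))
        [.cons .nil (.cons (natToData 5) a),
          .cons .nil (.cons (natToData 4) (.cons f (.cons i a))),
          .cons .nil (.cons (natToData 4) (.cons f (.cons a i)))])
      (fun _ => rfl) (fun _ _ => rfl)).symm
  · obtain h0 : m n = 0 := by omega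
    rw [dif_neg (by omega), h0]
    rfl

namespace SKQES

variable {S : SKQES}

/-- The forger that runs a CPA adversary, with the instructions `r` inserted before the challenge,
and produces a valid ciphertext if and only if the adversary returns `1`. -/
def CPAAdversary.toForger (A : S.CPAAdversary)
    (r : ∀ n, List (OGate (AdvWire (S.m n) (S.c n) (A.work n))))
    (hr : PolyTime fun n => listToData ToData.toData (r n)) : S.Forger where
  work := A.work
  circuit n := (A.pre n ++ (r n ++ .query :: A.post n)) ++ finish _ _ _
  uniform := by
    have hm : PolyTime fun n => natToData (S.m n) :=
      S.enc_uniform.map (F := fun x => x.snd.fst) (.fst (.snd .id))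
    have hc : PolyTime fun n => natToData (S.c n) :=
      S.enc_uniform.map (F := fun x => x.snd.snd.fst) (.fst (.snd (.snd .id)))
    have hw : PolyTime fun n => natToData (A.work n) :=
      A.uniform.map (F := fun x => x.fst) (.fst .id)
    have hpre : PolyTime fun n => listToData ToData.toData (A.pre n) :=
      A.uniform.map (F := fun x => x.snd.fst) (.fst (.snd .id))
    have hpost : PolyTime fun n => listToData ToData.toData (A.post n) :=
      A.uniform.map (F := fun x => x.snd.snd) (.snd (.snd .id))
    have hfinish := (polyTime_clearCipher A.work hm hc).map
      (F := fun x => .cons (.cons .nil (.cons (natToData 0)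
        (.cons (.cons .nil .nil) (.cons (.cons .nil .nil) .nil)))) (.cons .nil x))
      (.cons (.const _) (.cons .nil .id))
    have h := hw.pair ((hpre.append (hr.append (hpost.map (F := fun x => .cons .nil x)
      (.cons .nil .id)))).append hfinish)
    convert h using 2 with n
    have e1 : Data.cons .nil (listToData ToData.toData (A.post n)) =
        listToData ToData.toData (OGate.query :: A.post n) := rfl
    rw [e1, append_listToData, append_listToData]
    exact congrArg (Data.cons _) (append_listToData _ _ (finish _ _ _)).symm

/-- Stated for a general challenge channel Φ, so that it serves the unchanged run and the run with
reset plaintext: `hΦ` says that the inserted instructions turn the query into Φ. The estimate for a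
fixed key is averaged over the keys. -/
theorem abs_forgeProb_sub_cpaProb_le {ε : ℕ → ℝ}
    (hε : ∀ n (k : Bits (S.κ n)), S.keyProb n k ≠ 0 → ∀ ρ : Op (Bits (S.m n)), ρ.PosSemidef →
      ρ.trace.re ≤ 1 → |acceptProb (S.decCircuit n) k (S.enc n k ρ) - ρ.trace.re| ≤ ε n)
    (A : S.CPAAdversary) (r : ∀ n, List (OGate (AdvWire (S.m n) (S.c n) (A.work n))))
    (hr : PolyTime fun n => listToData ToData.toData (r n)) {n : ℕ} (hm : 0 < S.m n)
    (Φ : Bits (S.κ n) → Op (Bits (S.m n)) → Op (Bits (S.c n)))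
    (hΦ : ∀ k s, runOracle (S.realCall n k) (r n ++ .query :: A.post n) s =
      runOracle (S.realCall n k) (A.post n) ⟨s.1 + 1, oracleCall (tensorId (Φ k)) s.2⟩) :
    |forgeProb (A.toForger r hr) n - cpaProb A n Φ| ≤ |ε n| + S.zeroAccept n := by
  have hsplit : |ε n| + S.zeroAccept n = ∑ k, S.keyProb n k *
      (|ε n| + acceptProb (S.decCircuit n) k (ketbra zeros)) := by
    simp only [mul_add, Finset.sum_add_distrib, ← Finset.sum_mul]
    rw [show ∑ k, S.keyProb n k = 1 from sum_keyDist _, one_mul]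
    rfl
  rw [hsplit, forgeProb, cpaProb, ← Finset.sum_sub_distrib]
  refine (Finset.abs_sum_le_sum_abs _ _).trans (Finset.sum_le_sum fun k _ => ?_)
  have hp : 0 ≤ S.keyProb n k := keyDist_nonneg _ k
  rw [← mul_sub, abs_mul, abs_of_nonneg hp]
  -- Correctness is available only for keys in the support; other keys have weight 0.
  by_cases hk : S.keyProb n k = 0
  · rw [hk, zero_mul, zero_mul]
  refine mul_le_mul_of_nonneg_left ?_ hp
  have h := abs_accept_finish_sub_le hε hm hk
    (isDensity_runOracle n k (A.pre n ++ (r n ++ .query :: A.post n))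
      (isDensity_startState _ _ (A.work n)))
  rw [← runOracle_append, runOracle_append _ (A.pre n), hΦ] at h
  exact h.trans (by gcongr; exact le_abs_self _)

/-- The heart of the argument: this oracle only takes the trace over the plaintext register, and
resetting does not change that trace. -/
theorem cheatCall_resetPlain (D : S.Decomposition) (n : ℕ) (k : Bits (S.κ n)) (j : ℕ) {w : ℕ}
    (X : Op ((AdvWire (S.m n) (S.c n) w → Bool) × D.CheatMem n j)) :
    oracleCall (D.cheatCall n k j) (tensorId (runGates (resetPlain _ _ _)) X) =
      oracleCall (D.cheatCall n k j) X := by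
  rw [oracleCall_eq, oracleCall_eq]
  simp only [Decomposition.cheatCall, of_apply, resetPlain, sum_plainBlock_resetAll]

theorem Decomposition.cheatProb_toForger_reset (D : S.Decomposition) (A : S.CPAAdversary) (h₀ h₁) :
    D.cheatProb (A.toForger (fun n => (resetPlain _ _ (A.work n)).map .gate) h₁) =
      D.cheatProb (A.toForger (fun _ => []) h₀) := by
  funext n
  refine Finset.sum_congr rfl fun k _ => ?_
  have h : ∀ s, runOracle (D.cheatCall n k)
      ((A.pre n ++ ((resetPlain _ _ (A.work n)).map .gate ++ .query :: A.post n)) ++ finish _ _ _)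
        s = runOracle (D.cheatCall n k)
      ((A.pre n ++ ([] ++ .query :: A.post n)) ++ finish _ _ _) s := by
    intro s
    simp only [runOracle_append, runOracle_gates, runOracle_query, cheatCall_resetPlain]
    rfl
  have h' := h (startState (S.m n) (S.c n) (A.work n) (Fin.elim0 : D.CheatMem n 0))
  exact congrArg (fun out : JointState (S.m n) (S.c n) (A.work n) (D.CheatMem n) =>
    S.keyProb n k * D.cheatLoop n k (List.finRange out.1)
      (tensorId (fun Y : Op (Bits (S.c n)) => (D.V n k)ᴴ * Y * D.V n k) (ciphertextPart out.2))) h'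

/-- With no plaintext qubits the space M is one-dimensional, so replacing the plaintext does
nothing. -/
theorem cpaProb_eq_of_no_plaintext (A : S.CPAAdversary) {n : ℕ} (hm : S.m n = 0) :
    cpaProb A n (fun k X => S.enc n k (Matrix.trace X • ketbra zeros)) =
      cpaProb A n (fun k => S.enc n k) := by
  have : IsEmpty (Fin (S.m n)) := hm ▸ Fin.isEmpty
  have h : ∀ X : Op (Bits (S.m n)), Matrix.trace X • ketbra zeros = X := by
    intro X
    ext a a'
    rw [Subsingleton.elim a zeros, Subsingleton.elim a' zeros]
    simpa [Matrix.trace, ketbra] using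
      congrArg₂ X (Subsingleton.elim _ _) (Subsingleton.elim _ _)
  simp only [h]

theorem isQINDCPA_of_isQUF (h : S.IsQUF) : S.IsQINDCPA := by
  intro A
  obtain ⟨D, hD⟩ := h
  obtain ⟨ε, hneg, hε⟩ := S.exists_correctness
  have hm : PolyTime fun n => natToData (S.m n) :=
    S.enc_uniform.map (F := fun x => x.snd.fst) (.fst (.snd .id))
  let F₀ := A.toForger (fun _ => []) (hm.map (F := fun _ => .nil) .nil)
  let F₁ := A.toForger (fun n => (resetPlain _ _ (A.work n)).map .gate)
    (polyTime_resetPlain S.c A.work hm)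
  have hcheat : D.cheatProb F₁ = D.cheatProb F₀ := D.cheatProb_toForger_reset A _ _
  -- The chain is CPA₀ ≈ forge F₀ ≈ cheat F₀ = cheat F₁ ≈ forge F₁ ≈ CPA₁. Each outer step costs |ε|
  -- and the acceptance probability of |0…0⟩, which appears here as the QUF gap of `idleForger`.
  have hbound : Negligible fun n => |forgeProb F₀ n - D.cheatProb F₀ n| +
      |forgeProb F₁ n - D.cheatProb F₁ n| +
      ((|ε n| + |forgeProb S.idleForger n - D.cheatProb S.idleForger n|) +
        (|ε n| + |forgeProb S.idleForger n - D.cheatProb S.idleForger n|)) := by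
    have hε' : Negligible fun n => |ε n| := hneg.trans_abs_le fun n => by simp
    have h1 := hε'.add (hD S.idleForger)
    exact ((hD F₀).add (hD F₁)).add (h1.add h1)
  refine hbound.trans_abs_le fun n => ?_
  rw [abs_abs, forgeProb_idleForger, cheatProb_idleForger, sub_zero]
  refine le_trans ?_ (le_abs_self _)
  have hz := le_abs_self (S.zeroAccept n)
  rcases Nat.eq_zero_or_pos (S.m n) with h0 | h0
  · rw [cpaProb_eq_of_no_plaintext A h0, sub_self, abs_zero]
    positivity
  · have b0 : |forgeProb F₀ n - _| ≤ _ := abs_forgeProb_sub_cpaProb_le hε A _ _ h0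
      (fun k => S.enc n k) (fun _ _ => by rw [List.nil_append, runOracle_query, realCall])
    have b1 : |forgeProb F₁ n - _| ≤ _ := abs_forgeProb_sub_cpaProb_le hε A _ _ h0
      (fun k X => S.enc n k (Matrix.trace X • ketbra zeros)) (fun k s => by
        rw [runOracle_append, runOracle_gates, runOracle_query]
        exact congrArg (fun Y : Op ((AdvWire (S.m n) (S.c n) (A.work n) → Bool) × Unit) =>
          runOracle (S.realCall n k) (A.post n) ⟨s.1 + 1, Y⟩)
            (oracleCall_resetAll (S.enc n k) s.2))
    rw [hcheat]
    have t0 := abs_le.mp b0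
    have t1 := abs_le.mp b1
    have t2 := abs_le.mp (le_refl |forgeProb F₀ n - D.cheatProb F₀ n|)
    have t3 := abs_le.mp (le_refl |forgeProb F₁ n - D.cheatProb F₀ n|)
    rw [abs_le]
    constructor <;> linarith [t0.1, t0.2, t1.1, t1.2, t2.1, t2.2, t3.1, t3.2]

end SKQES

end QEnc

theorem mainTheorem6 (S : QEnc.SKQES) (h : S.IsQUF) : S.IsQINDCPA :=
  QEnc.SKQES.isQINDCPA_of_isQUF h
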